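/- Let $G=(A_t,\Delta)$ be a compact quantum group, i.e. a unital $C^*$-algebra $A_t$ with a coassociative unital $*$-homomorphism $\Delta:A_t\to A_t\otimes A_t$ (minimal tensor product) such that the linear spans of $(A_t\otimes 1)\Delta(A_t)$ and $(1\otimes A_t)\Delta(A_t)$ are dense in $A_t\otimes A_t$. Finite-dimensional representations of $G$ are unitary matrices $u\in M_n(A_t)$ with $\Delta(u_{ij})=\sum_k u_{ik}\otimes u_{kj}$; $u$ is irreducible if $n\ge 1$ and the only $T\in M_n(\mathbb C)$ with $(T\otimes 1)u=u(T\otimes 1)$ are the scalars, and $u,v$ are equivalent if there is a unitary $T$ with $(T\otimes 1)u=v(T\otimes 1)$. Let $A\subseteq A_t$ be the CQG algebra of $G$, i.e. the Hopf $*$-algebra spanned by (equivalently, the $*$-subalgebra generated by) the matrix coefficients of the irreducible representations. Let $\operatorname{Aut}(G)$ be the group of Hopf $*$-algebra automorphisms of $A$ (the $*$-automorphisms $\alpha$ with $\Delta\circ\alpha=(\alpha\otimes\alpha)\circ\Delta$; equivalently, the coproduct-preserving automorphisms of the full enveloping $C^*$-algebra of $A$), with the group topology having as basic neighbourhoods of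 the identity the sets $$U(a_1,\dots,a_m;\varepsilon)=\{\alpha\in\operatorname{Aut}(G) : \|\alpha(a_i)-a_i\|<\varepsilon,\ 1\le i\le m\},\qquad a_i\in A,\ \varepsilon>0,$$ where $\|\cdot\|$ is the norm of the full enveloping $C^*$-algebra of $A$. Let $\operatorname{Aut}_\chi(G)\le\operatorname{Aut}(G)$, with the subspace topology, be the subgroup of inner automorphisms: those $\alpha$ for which $\alpha(u)=(\alpha(u_{ij}))$ is equivalent to $u$ for every irreducible representation $u$ of $G$. **Theorem (Iwasawa-type theorem).** For every compact quantum group $G$, the connected component of the identity $\operatorname{Aut}^0(G)$ of $\operatorname{Aut}(G)$ equals the connected component of the identity $\operatorname{Aut}^0_\chi(G)$ of $\operatorname{Aut}_\chi(G)$. -/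

import Mathlib

universe u

open scoped TensorProduct ENNReal InnerProductSpace

noncomputable section

namespace CQG

/-! ### Hilbert space tensor products and tensor products of bounded operators -/

section Operators

variable {H K : Type u}
  [NormedAddCommGroup H] [InnerProductSpace ℂ H] [CompleteSpace H]
  [NormedAddCommGroup K] [InnerProductSpace ℂ K] [CompleteSpace K]

theorem inner_map_map_adjoint (S : H →L[ℂ] H) (T : K →L[ℂ] K) (x y : H ⊗[ℂ] K) :
    ⟪TensorProduct.map (S : H →ₗ[ℂ] H) (T : K →ₗ[ℂ] K) x, y⟫_ℂ =
      ⟪x, TensorProduct.map ((star S : H →L[ℂ] H) : H →ₗ[ℂ] H)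
        ((star T : K →L[ℂ] K) : K →ₗ[ℂ] K) y⟫_ℂ := by
  induction x with
  | zero => simp
  | add x₁ x₂ h₁ h₂ => simp [inner_add_left, h₁, h₂]
  | tmul a b =>
    induction y with
    | zero => simp
    | add y₁ y₂ h₁ h₂ => simp only [map_add, inner_add_right, h₁, h₂]
    | tmul c d =>
      simp [ContinuousLinearMap.star_eq_adjoint, ContinuousLinearMap.adjoint_inner_right]

theorem norm_map_left_le (S : H →L[ℂ] H) (x : H ⊗[ℂ] K) :
    ‖TensorProduct.map (S : H →ₗ[ℂ] H) (LinearMap.id : K →ₗ[ℂ] K) x‖ ≤ ‖S‖ * ‖x‖ := by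
  have hle : star S * S ≤ algebraMap ℝ (H →L[ℂ] H) (‖S‖ ^ 2) :=
    CStarAlgebra.star_mul_le_algebraMap_norm_sq
  obtain ⟨R, hR⟩ := CStarAlgebra.nonneg_iff_eq_star_mul_self.mp (sub_nonneg.mpr hle)
  have key : ∀ U : H →L[ℂ] H,
      ⟪TensorProduct.map (U : H →ₗ[ℂ] H) (LinearMap.id : K →ₗ[ℂ] K) x,
        TensorProduct.map (U : H →ₗ[ℂ] H) (LinearMap.id : K →ₗ[ℂ] K) x⟫_ℂ =
      ⟪x, TensorProduct.map ((star U * U : H →L[ℂ] H) : H →ₗ[ℂ] H)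
        (LinearMap.id : K →ₗ[ℂ] K) x⟫_ℂ := by
    intro U
    have h := inner_map_map_adjoint U (1 : K →L[ℂ] K) x
      (TensorProduct.map (U : H →ₗ[ℂ] H) (LinearMap.id : K →ₗ[ℂ] K) x)
    rw [star_one] at h
    have h1 : ((1 : K →L[ℂ] K) : K →ₗ[ℂ] K) = LinearMap.id := rfl
    rw [h1] at h
    rw [h, ← LinearMap.comp_apply, ← TensorProduct.map_comp]
    rfl
  have hsum : (‖S‖ ^ 2 * ‖x‖ ^ 2 : ℝ) =
      ‖TensorProduct.map (S : H →ₗ[ℂ] H) (LinearMap.id : K →ₗ[ℂ] K) x‖ ^ 2 +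
      ‖TensorProduct.map (R : H →ₗ[ℂ] H) (LinearMap.id : K →ₗ[ℂ] K) x‖ ^ 2 := by
    have hadd : ((star S * S : H →L[ℂ] H) : H →ₗ[ℂ] H) + ((star R * R : H →L[ℂ] H) : H →ₗ[ℂ] H)
        = ((‖S‖ ^ 2 : ℝ) : ℂ) • LinearMap.id := by
      rw [← hR]
      ext v
      simp [Algebra.algebraMap_eq_smul_one]
      rw [← Complex.ofReal_pow, Complex.coe_smul]
    have h3 : (((‖S‖ ^ 2 * ‖x‖ ^ 2 : ℝ)) : ℂ) = ⟪x, TensorProduct.map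
        (((star S * S : H →L[ℂ] H) : H →ₗ[ℂ] H) + ((star R * R : H →L[ℂ] H) : H →ₗ[ℂ] H))
        (LinearMap.id : K →ₗ[ℂ] K) x⟫_ℂ := by
      rw [hadd, TensorProduct.map_smul_left, TensorProduct.map_id]
      simp [inner_smul_right, inner_self_eq_norm_sq_to_K]
    rw [TensorProduct.map_add_left, LinearMap.add_apply, inner_add_right, ← key, ← key] at h3
    have hS := inner_self_eq_norm_sq_to_K (𝕜 := ℂ)
      (TensorProduct.map (S : H →ₗ[ℂ] H) (LinearMap.id : K →ₗ[ℂ] K) x)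
    have hR := inner_self_eq_norm_sq_to_K (𝕜 := ℂ)
      (TensorProduct.map (R : H →ₗ[ℂ] H) (LinearMap.id : K →ₗ[ℂ] K) x)
    have h4 := h3.trans (congrArg₂ (· + ·) hS hR)
    apply Complex.ofReal_injective
    rw [h4]
    push_cast
    rfl
  refine le_of_sq_le_sq ?_ (by positivity)
  rw [mul_pow, hsum]
  exact le_add_of_nonneg_right (by positivity)

theorem norm_map_right_le (T : K →L[ℂ] K) (x : H ⊗[ℂ] K) :
    ‖TensorProduct.map (LinearMap.id : H →ₗ[ℂ] H) (T : K →ₗ[ℂ] K) x‖ ≤ ‖T‖ * ‖x‖ := by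
  have e : TensorProduct.comm ℂ K H (TensorProduct.map (T : K →ₗ[ℂ] K)
      (LinearMap.id : H →ₗ[ℂ] H) (TensorProduct.comm ℂ H K x)) =
      TensorProduct.map (LinearMap.id : H →ₗ[ℂ] H) (T : K →ₗ[ℂ] K) x := by
    induction x with
    | zero => simp
    | add _ _ h₁ h₂ => simp only [map_add, h₁, h₂]
    | tmul a b => simp
  have h := norm_map_left_le T (TensorProduct.comm ℂ H K x)
  rwa [TensorProduct.norm_comm, ← TensorProduct.norm_comm, e] at h

theorem norm_map_le (S : H →L[ℂ] H) (T : K →L[ℂ] K) (x : H ⊗[ℂ] K) :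
    ‖TensorProduct.map (S : H →ₗ[ℂ] H) (T : K →ₗ[ℂ] K) x‖ ≤ ‖S‖ * ‖T‖ * ‖x‖ := by
  have e : TensorProduct.map (S : H →ₗ[ℂ] H) (T : K →ₗ[ℂ] K) x =
      TensorProduct.map (S : H →ₗ[ℂ] H) (LinearMap.id : K →ₗ[ℂ] K)
        (TensorProduct.map (LinearMap.id : H →ₗ[ℂ] H) (T : K →ₗ[ℂ] K) x) := by
    rw [← LinearMap.comp_apply, ← TensorProduct.map_comp]
    rfl
  rw [e, mul_assoc]
  exact (norm_map_left_le S _).trans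
    (mul_le_mul_of_nonneg_left (norm_map_right_le T x) (norm_nonneg S))

variable (H K) in
/-- The Hilbert space tensor product: the completion of the algebraic tensor product for the inner
product `⟪h ⊗ k, h' ⊗ k'⟫ = ⟪h, h'⟫ ⟪k, k'⟫`. -/
def HTensor : Type u := UniformSpace.Completion (H ⊗[ℂ] K)

instance : NormedAddCommGroup (HTensor H K) :=
  inferInstanceAs (NormedAddCommGroup (UniformSpace.Completion (H ⊗[ℂ] K)))

instance : InnerProductSpace ℂ (HTensor H K) :=
  inferInstanceAs (InnerProductSpace ℂ (UniformSpace.Completion (H ⊗[ℂ] K)))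

instance : CompleteSpace (HTensor H K) :=
  inferInstanceAs (CompleteSpace (UniformSpace.Completion (H ⊗[ℂ] K)))

/-- The inclusion of the algebraic tensor product into its completion. -/
def toHTensor : H ⊗[ℂ] K →ₗᵢ[ℂ] HTensor H K := UniformSpace.Completion.toComplₗᵢ

/-- The elementary tensor `h ⊗ k` in the Hilbert space tensor product. -/
def htmul (h : H) (k : K) : HTensor H K := toHTensor (h ⊗ₜ[ℂ] k)

instance [Nontrivial H] [Nontrivial K] : Nontrivial (HTensor H K) := by
  obtain ⟨h, hh⟩ := exists_ne (0 : H)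
  obtain ⟨k, hk⟩ := exists_ne (0 : K)
  refine ⟨htmul h k, 0, fun e => ?_⟩
  have := congrArg norm e
  simp [htmul, hh, hk] at this

set_option linter.unusedSectionVars false in
theorem denseRange_toHTensor : DenseRange (toHTensor : H ⊗[ℂ] K →ₗᵢ[ℂ] HTensor H K) :=
  UniformSpace.Completion.denseRange_coe

/-- The bounded operator `S ⊗ T` on the Hilbert space tensor product. -/
def opTensor (S : H →L[ℂ] H) (T : K →L[ℂ] K) : HTensor H K →L[ℂ] HTensor H K :=
  ((TensorProduct.map (S : H →ₗ[ℂ] H) (T : K →ₗ[ℂ] K)).mkContinuous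
    (‖S‖ * ‖T‖) (norm_map_le S T)).completion

theorem opTensor_coe (S : H →L[ℂ] H) (T : K →L[ℂ] K) (x : H ⊗[ℂ] K) :
    opTensor S T (toHTensor x) =
      toHTensor (TensorProduct.map (S : H →ₗ[ℂ] H) (T : K →ₗ[ℂ] K) x) :=
  ContinuousLinearMap.completion_apply_coe _ x

theorem clm_ext_coe {f g : HTensor H K →L[ℂ] HTensor H K}
    (h : ∀ x : H ⊗[ℂ] K, f (toHTensor x) = g (toHTensor x)) : f = g := by
  ext c
  exact denseRange_toHTensor.induction_on c (isClosed_eq f.continuous g.continuous) h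

theorem opTensor_norm_le (S : H →L[ℂ] H) (T : K →L[ℂ] K) : ‖opTensor S T‖ ≤ ‖S‖ * ‖T‖ := by
  refine ContinuousLinearMap.opNorm_le_bound _ (by positivity) fun c => ?_
  refine denseRange_toHTensor.induction_on c (isClosed_le (by fun_prop) (by fun_prop)) fun c => ?_
  rw [opTensor_coe, LinearIsometry.norm_map, LinearIsometry.norm_map]
  exact norm_map_le S T c

theorem opTensor_one : opTensor (1 : H →L[ℂ] H) (1 : K →L[ℂ] K) = 1 := by
  refine clm_ext_coe fun x => ?_
  rw [opTensor_coe]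
  have : TensorProduct.map ((1 : H →L[ℂ] H) : H →ₗ[ℂ] H) ((1 : K →L[ℂ] K) : K →ₗ[ℂ] K) =
    LinearMap.id := TensorProduct.map_id
  rw [this]
  rfl

theorem opTensor_mul (S S' : H →L[ℂ] H) (T T' : K →L[ℂ] K) :
    opTensor (S * S') (T * T') = opTensor S T * opTensor S' T' := by
  refine clm_ext_coe fun x => ?_
  have e : (opTensor S T * opTensor S' T') (toHTensor x) =
    opTensor S T (opTensor S' T' (toHTensor x)) := rfl
  rw [e, opTensor_coe, opTensor_coe, opTensor_coe, ← LinearMap.comp_apply,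
    ← TensorProduct.map_comp]
  rfl

theorem opTensor_star (S : H →L[ℂ] H) (T : K →L[ℂ] K) :
    opTensor (star S) (star T) = star (opTensor S T) := by
  rw [ContinuousLinearMap.star_eq_adjoint (opTensor S T)]
  refine (ContinuousLinearMap.eq_adjoint_iff _ _).mpr fun x y => ?_
  refine denseRange_toHTensor.induction_on₂ (p := fun x y => ⟪opTensor (star S) (star T) x, y⟫_ℂ =
    ⟪x, opTensor S T y⟫_ℂ) (isClosed_eq (by fun_prop) (by fun_prop)) (fun x y => ?_) x y
  rw [opTensor_coe, opTensor_coe, LinearIsometry.inner_map_map, LinearIsometry.inner_map_map,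
      inner_map_map_adjoint, star_star, star_star]

/-- The operator `S ⊗ T` as a bilinear expression in `S` and `T`. -/
def opTensorBilin :
    (H →L[ℂ] H) →ₗ[ℂ] (K →L[ℂ] K) →ₗ[ℂ] (HTensor H K →L[ℂ] HTensor H K) :=
  LinearMap.mk₂ ℂ opTensor
    (fun S S' T => clm_ext_coe fun x => by
      rw [_root_.add_apply, opTensor_coe, opTensor_coe, opTensor_coe,
        ContinuousLinearMap.toLinearMap_add, TensorProduct.map_add_left, LinearMap.add_apply,
        map_add])
    (fun c S T => clm_ext_coe fun x => by
      rw [_root_.smul_apply, opTensor_coe, opTensor_coe,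
        ContinuousLinearMap.toLinearMap_smul, TensorProduct.map_smul_left, LinearMap.smul_apply,
        map_smul])
    (fun S T T' => clm_ext_coe fun x => by
      rw [_root_.add_apply, opTensor_coe, opTensor_coe, opTensor_coe,
        ContinuousLinearMap.toLinearMap_add, TensorProduct.map_add_right, LinearMap.add_apply,
        map_add])
    (fun c S T => clm_ext_coe fun x => by
      rw [_root_.smul_apply, opTensor_coe, opTensor_coe,
        ContinuousLinearMap.toLinearMap_smul, TensorProduct.map_smul_right, LinearMap.smul_apply,
        map_smul])

end Operators

/-! ### The minimal (spatial) tensor product of unital C⋆-algebras -/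

/-- A unital ⋆-representation of a C⋆-algebra on a nonzero Hilbert space. -/
structure HilbertRep (A : Type u) [CStarAlgebra A] where
  space : Type u
  [normed : NormedAddCommGroup space]
  [inner : InnerProductSpace ℂ space]
  [complete : CompleteSpace space]
  [nontrivial : Nontrivial space]
  hom : A →⋆ₐ[ℂ] (space →L[ℂ] space)

attribute [instance] HilbertRep.normed HilbertRep.inner HilbertRep.complete HilbertRep.nontrivial

section MinTensor

variable {A B : Type u} [CStarAlgebra A] [CStarAlgebra B]

/-- The linear map `a ⊗ b ↦ π a ⊗ σ b`. -/
def tensorRepLin (π : HilbertRep A) (σ : HilbertRep B) :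
    A ⊗[ℂ] B →ₗ[ℂ] (HTensor π.space σ.space →L[ℂ] HTensor π.space σ.space) :=
  TensorProduct.lift
    ((opTensorBilin (H := π.space) (K := σ.space)).compl₁₂ (π.hom : A →ₗ[ℂ] _) (σ.hom : B →ₗ[ℂ] _))

theorem tensorRepLin_tmul (π : HilbertRep A) (σ : HilbertRep B) (a : A) (b : B) :
    tensorRepLin π σ (a ⊗ₜ b) = opTensor (π.hom a) (σ.hom b) := rfl

/-- The algebra homomorphism underlying `tensorRep`. -/
def tensorRepAlg (π : HilbertRep A) (σ : HilbertRep B) :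
    A ⊗[ℂ] B →ₐ[ℂ] (HTensor π.space σ.space →L[ℂ] HTensor π.space σ.space) :=
  Algebra.TensorProduct.algHomOfLinearMapTensorProduct (tensorRepLin π σ)
    (fun a a' b b' => by
      rw [tensorRepLin_tmul, tensorRepLin_tmul, tensorRepLin_tmul, map_mul, map_mul, opTensor_mul])
    (by rw [tensorRepLin_tmul, map_one, map_one, opTensor_one])

/-- The ⋆-representation `π ⊗ σ` of the algebraic tensor product `A ⊗ B` on the Hilbert space
tensor product. -/
def tensorRep (π : HilbertRep A) (σ : HilbertRep B) :
    A ⊗[ℂ] B →⋆ₐ[ℂ] (HTensor π.space σ.space →L[ℂ] HTensor π.space σ.space) where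
  toAlgHom := tensorRepAlg π σ
  map_star' t := by
    induction t with
    | zero => simp
    | add x y hx hy =>
      rw [star_add]
      change tensorRepAlg π σ (star x + star y) = star (tensorRepAlg π σ (x + y))
      rw [map_add, map_add, star_add]
      exact congrArg₂ (· + ·) hx hy
    | tmul a b =>
      change opTensor (π.hom (star a)) (σ.hom (star b)) = star (opTensor (π.hom a) (σ.hom b))
      rw [map_star, map_star, opTensor_star]

theorem tensorRep_tmul (π : HilbertRep A) (σ : HilbertRep B) (a : A) (b : B) :
    tensorRep π σ (a ⊗ₜ b) = opTensor (π.hom a) (σ.hom b) := rfl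

theorem tensorRep_bdd (t : A ⊗[ℂ] B) :
    ∃ C : ℝ, ∀ (π : HilbertRep A) (σ : HilbertRep B), ‖tensorRep π σ t‖ ≤ C := by
  induction t with
  | zero => exact ⟨0, fun π σ => by simp⟩
  | add x y hx hy =>
    obtain ⟨C, hC⟩ := hx
    obtain ⟨D, hD⟩ := hy
    refine ⟨C + D, fun π σ => ?_⟩
    rw [map_add]
    exact (norm_add_le _ _).trans (add_le_add (hC π σ) (hD π σ))
  | tmul a b =>
    refine ⟨‖a‖ * ‖b‖, fun π σ => ?_⟩
    rw [tensorRep_tmul]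
    exact (opTensor_norm_le _ _).trans (mul_le_mul (NonUnitalStarAlgHom.norm_apply_le π.hom a)
      (NonUnitalStarAlgHom.norm_apply_le σ.hom b) (norm_nonneg _) (norm_nonneg _))

variable (A B) in
/-- The C⋆-algebra of uniformly bounded families of operators, one on each Hilbert space
`π.space ⊗ σ.space`, with the supremum norm. -/
abbrev RepProd : Type (u + 1) :=
  lp (fun p : HilbertRep A × HilbertRep B =>
    HTensor p.1.space p.2.space →L[ℂ] HTensor p.1.space p.2.space) ∞

/-- The canonical map `t ↦ ((π ⊗ σ) t)_{π, σ}`. -/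
def toRepProd : A ⊗[ℂ] B →⋆ₐ[ℂ] RepProd A B where
  toFun t := ⟨fun p => tensorRep p.1 p.2 t, memℓp_infty (by
    obtain ⟨C, hC⟩ := tensorRep_bdd t
    exact ⟨C, by rintro _ ⟨p, rfl⟩; exact hC p.1 p.2⟩)⟩
  map_one' := by ext1; funext p; exact map_one (tensorRep p.1 p.2)
  map_mul' s t := by ext1; funext p; exact map_mul (tensorRep p.1 p.2) s t
  map_zero' := by ext1; funext p; exact map_zero (tensorRep p.1 p.2)
  map_add' s t := by ext1; funext p; exact map_add (tensorRep p.1 p.2) s t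
  commutes' c := by ext1; funext p; exact (tensorRep p.1 p.2).commutes' c
  map_star' t := by ext1; funext p; exact map_star (tensorRep p.1 p.2) t

variable (A B) in
/-- The closure of the image of the algebraic tensor product in `RepProd A B`. -/
def minSubalgebra : StarSubalgebra ℂ (RepProd A B) :=
  (toRepProd (A := A) (B := B)).range.topologicalClosure

instance : CStarAlgebra (RepProd A B) where

instance : IsClosed (minSubalgebra A B : Set (RepProd A B)) :=
  StarSubalgebra.isClosed_topologicalClosure _

variable (A B) in
/-- The minimal tensor product of two unital C⋆-algebras: the completion of the algebraic tensor
product for the norm `‖t‖ = sup_{π, σ} ‖(π ⊗ σ) t‖`, where `π` and `σ` run over all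
⋆-representations on Hilbert spaces; it is realised as a closed subalgebra of `RepProd A B`. -/
def MinTensor : Type (u + 1) := minSubalgebra A B

instance : CStarAlgebra (MinTensor A B) := inferInstanceAs (CStarAlgebra (minSubalgebra A B))

/-- The canonical map from the algebraic to the minimal tensor product. -/
def toMin : A ⊗[ℂ] B →⋆ₐ[ℂ] MinTensor A B :=
  toRepProd.codRestrict (minSubalgebra A B) fun t => StarSubalgebra.le_topologicalClosure _ ⟨t, rfl⟩

/-- The extension of `π ⊗ σ` to the minimal tensor product. -/
def minRep (π : HilbertRep A) (σ : HilbertRep B) :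
    MinTensor A B →⋆ₐ[ℂ] (HTensor π.space σ.space →L[ℂ] HTensor π.space σ.space) where
  toFun x := (x.1 : RepProd A B) (π, σ)
  map_one' := rfl
  map_mul' _ _ := rfl
  map_zero' := rfl
  map_add' _ _ := rfl
  commutes' _ := rfl
  map_star' _ := rfl

theorem minRep_toMin (π : HilbertRep A) (σ : HilbertRep B) (t : A ⊗[ℂ] B) :
    minRep π σ (toMin t) = tensorRep π σ t := rfl

/-- For `Δ : A → A ⊗ A`, the ⋆-representation `(π ⊗ σ) ∘ Δ` of `A`. -/
abbrev convRep (Δ : A →⋆ₐ[ℂ] MinTensor A A) (π σ : HilbertRep A) : HilbertRep A where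
  space := HTensor π.space σ.space
  hom := (minRep π σ).comp Δ

end MinTensor

/-! ### Compact quantum groups -/

/-- A compact quantum group: a unital C⋆-algebra `A` together with a coassociative comultiplication
`Δ : A → A ⊗ A` such that `(A ⊗ 1) Δ(A)` and `(1 ⊗ A) Δ(A)` span dense subspaces of `A ⊗ A`.

Coassociativity `(Δ ⊗ id) Δ = (id ⊗ Δ) Δ` is an identity in `A ⊗ A ⊗ A`, on which the
representations `π ⊗ σ ⊗ τ` are jointly faithful. Since `(π ⊗ σ ⊗ τ) ∘ (Δ ⊗ id)` is
`((π ⊗ σ) ∘ Δ) ⊗ τ` and `(π ⊗ σ ⊗ τ) ∘ (id ⊗ Δ)` is `π ⊗ ((σ ⊗ τ) ∘ Δ)`, it says that the operators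
which these two assign to `Δ a` correspond to each other under the canonical identification of
`(H ⊗ K) ⊗ L` with `H ⊗ (K ⊗ L)`, that is, have the same matrix coefficients on elementary
tensors. -/
structure CompactQuantumGroup (A : Type u) [CStarAlgebra A] where
  comul : A →⋆ₐ[ℂ] MinTensor A A
  coassoc : ∀ (π σ τ : HilbertRep A) (a : A) (h h' : π.space) (k k' : σ.space) (l l' : τ.space),
    ⟪htmul (htmul h k) l,
      minRep (convRep comul π σ) τ (comul a) (htmul (htmul h' k') l')⟫_ℂ =
    ⟪htmul h (htmul k l),
      minRep π (convRep comul σ τ) (comul a) (htmul h' (htmul k' l'))⟫_ℂ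
  dense_left : Dense (Submodule.span ℂ
    {x : MinTensor A A | ∃ a b : A, x = toMin (a ⊗ₜ 1) * comul b} : Set (MinTensor A A))
  dense_right : Dense (Submodule.span ℂ
    {x : MinTensor A A | ∃ a b : A, x = toMin (1 ⊗ₜ a) * comul b} : Set (MinTensor A A))

section Intertwiners

variable {R S : Type u} [Ring R] [Algebra ℂ R] [Ring S] [Algebra ℂ S] {n : ℕ}

/-- The scalar matrix `T` intertwines the matrices `u` and `v` with entries in a complex algebra:
`(T ⊗ 1) u = v (T ⊗ 1)`. -/
def Intertwines (T : Matrix (Fin n) (Fin n) ℂ) (u v : Matrix (Fin n) (Fin n) R) : Prop :=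
  T.map (algebraMap ℂ R) * u = v * T.map (algebraMap ℂ R)

/-- Unitary equivalence: there is a unitary intertwiner. -/
def UnitarilyEquivalent (u v : Matrix (Fin n) (Fin n) R) : Prop :=
  ∃ T ∈ Matrix.unitaryGroup (Fin n) ℂ, Intertwines T u v

theorem intertwines_map_iff (f : R →ₐ[ℂ] S) (hf : Function.Injective f)
    (T : Matrix (Fin n) (Fin n) ℂ) (u v : Matrix (Fin n) (Fin n) R) :
    Intertwines T (u.map f) (v.map f) ↔ Intertwines T u v := by
  have hT : T.map (algebraMap ℂ S) = (T.map (algebraMap ℂ R)).map f := by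
    ext i j; simp
  unfold Intertwines
  rw [hT, ← Matrix.map_mul, ← Matrix.map_mul]
  exact (Matrix.map_injective hf).eq_iff

theorem unitarilyEquivalent_map_iff (f : R →ₐ[ℂ] S) (hf : Function.Injective f)
    (u v : Matrix (Fin n) (Fin n) R) :
    UnitarilyEquivalent (u.map f) (v.map f) ↔ UnitarilyEquivalent u v := by
  unfold UnitarilyEquivalent
  simp only [intertwines_map_iff f hf]

theorem UnitarilyEquivalent.refl (u : Matrix (Fin n) (Fin n) R) : UnitarilyEquivalent u u :=
  ⟨1, one_mem _, by simp [Intertwines, Matrix.map_one]⟩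

theorem UnitarilyEquivalent.symm {u v : Matrix (Fin n) (Fin n) R}
    (h : UnitarilyEquivalent u v) : UnitarilyEquivalent v u := by
  obtain ⟨T, hT, h⟩ := h
  have h1 : (star T).map (algebraMap ℂ R) * T.map (algebraMap ℂ R) = 1 := by
    rw [← Matrix.map_mul, Matrix.mem_unitaryGroup_iff'.mp hT]; simp [Matrix.map_one]
  have h2 : T.map (algebraMap ℂ R) * (star T).map (algebraMap ℂ R) = 1 := by
    rw [← Matrix.map_mul, Matrix.mem_unitaryGroup_iff.mp hT]; simp [Matrix.map_one]
  refine ⟨star T, Unitary.star_mem hT, ?_⟩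
  unfold Intertwines at h ⊢
  calc _ = (star T).map (algebraMap ℂ R) * (v * T.map (algebraMap ℂ R)) *
        (star T).map (algebraMap ℂ R) := by rw [mul_assoc, mul_assoc v, h2, mul_one]
    _ = _ := by rw [← h, ← mul_assoc, h1, one_mul]

theorem UnitarilyEquivalent.trans {u v w : Matrix (Fin n) (Fin n) R}
    (h : UnitarilyEquivalent u v) (h' : UnitarilyEquivalent v w) : UnitarilyEquivalent u w := by
  obtain ⟨T, hT, h⟩ := h
  obtain ⟨S, hS, h'⟩ := h'
  refine ⟨S * T, mul_mem hS hT, ?_⟩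
  unfold Intertwines at *
  rw [Matrix.map_mul, mul_assoc, h, ← mul_assoc, h', mul_assoc]

end Intertwiners

namespace CompactQuantumGroup

variable {A : Type u} [CStarAlgebra A] (G : CompactQuantumGroup A)

/-- A finite-dimensional (unitary) representation of `G` on `ℂⁿ`: a unitary matrix `u` with entries
in `A` such that `Δ(u i j) = ∑ k, u i k ⊗ u k j`. -/
structure UnitaryRep (n : ℕ) where
  u : Matrix (Fin n) (Fin n) A
  mem_unitary : u ∈ unitary (Matrix (Fin n) (Fin n) A)
  comul_apply : ∀ i j, G.comul (u i j) = ∑ k, toMin (u i k ⊗ₜ u k j)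

variable {G} in
/-- A nonzero representation is irreducible if its only self-intertwiners are the scalars. -/
def UnitaryRep.IsIrreducible {n : ℕ} (w : G.UnitaryRep n) : Prop :=
  0 < n ∧ ∀ T : Matrix (Fin n) (Fin n) ℂ, Intertwines T w.u w.u → ∃ c : ℂ, T = c • 1

/-- The CQG algebra of `G`: the ⋆-subalgebra of `A` generated by the matrix coefficients of the
irreducible representations (it is also their linear span). -/
def coeffAlgebra : StarSubalgebra ℂ A :=
  StarAlgebra.adjoin ℂ
    {x | ∃ (n : ℕ) (w : G.UnitaryRep n), w.IsIrreducible ∧ ∃ i j, w.u i j = x}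

variable {G} in
/-- The matrix of an irreducible representation, with its entries taken in the CQG algebra. -/
def UnitaryRep.coeff {n : ℕ} (w : G.UnitaryRep n) (hw : w.IsIrreducible) :
    Matrix (Fin n) (Fin n) G.coeffAlgebra :=
  Matrix.of fun i j => ⟨w.u i j, StarAlgebra.subset_adjoin ℂ _ ⟨n, w, hw, i, j, rfl⟩⟩

/-- The inclusion of the algebraic tensor square of the CQG algebra in `A ⊗ A`. -/
def coeffTensor : G.coeffAlgebra ⊗[ℂ] G.coeffAlgebra →ₐ[ℂ] MinTensor A A :=
  (toMin (A := A) (B := A)).toAlgHom.comp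
    (Algebra.TensorProduct.map G.coeffAlgebra.subtype.toAlgHom G.coeffAlgebra.subtype.toAlgHom)

theorem coeffTensor_tmul (a b : G.coeffAlgebra) :
    G.coeffTensor (a ⊗ₜ b) = toMin ((a : A) ⊗ₜ (b : A)) := rfl

/-- The automorphisms of the Hopf ⋆-algebra `G.coeffAlgebra`: the ⋆-algebra automorphisms `α` which
respect the comultiplication, `Δ ∘ α = (α ⊗ α) ∘ Δ`. (An element `t` of the algebraic tensor square
is the coproduct of `a` exactly if `(α ⊗ α) t` is the coproduct of `α a`.) -/
def autSubgroup : Subgroup (G.coeffAlgebra ≃⋆ₐ[ℂ] G.coeffAlgebra) where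
  carrier := {α | ∀ (a : G.coeffAlgebra) (t : G.coeffAlgebra ⊗[ℂ] G.coeffAlgebra),
    G.comul a = G.coeffTensor t ↔
      G.comul (α a) = G.coeffTensor
        (TensorProduct.map (α : G.coeffAlgebra →ₗ[ℂ] G.coeffAlgebra)
          (α : G.coeffAlgebra →ₗ[ℂ] G.coeffAlgebra) t)}
  one_mem' a t := by
    have : TensorProduct.map ((1 : G.coeffAlgebra ≃⋆ₐ[ℂ] G.coeffAlgebra) :
        G.coeffAlgebra →ₗ[ℂ] G.coeffAlgebra) ((1 : G.coeffAlgebra ≃⋆ₐ[ℂ] G.coeffAlgebra) :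
        G.coeffAlgebra →ₗ[ℂ] G.coeffAlgebra) = LinearMap.id := TensorProduct.map_id
    rw [this]
    rfl
  mul_mem' {α β} hα hβ a t := by
    rw [hβ a t, hα, ← LinearMap.comp_apply, ← TensorProduct.map_comp]
    rfl
  inv_mem' {α} hα a t := by
    have e : TensorProduct.map (α : G.coeffAlgebra →ₗ[ℂ] G.coeffAlgebra)
        (α : G.coeffAlgebra →ₗ[ℂ] G.coeffAlgebra)
        (TensorProduct.map ((α⁻¹ : G.coeffAlgebra ≃⋆ₐ[ℂ] G.coeffAlgebra) :
            G.coeffAlgebra →ₗ[ℂ] G.coeffAlgebra)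
          ((α⁻¹ : G.coeffAlgebra ≃⋆ₐ[ℂ] G.coeffAlgebra) :
            G.coeffAlgebra →ₗ[ℂ] G.coeffAlgebra) t) = t := by
      have hc : (α : G.coeffAlgebra →ₗ[ℂ] G.coeffAlgebra) ∘ₗ
          ((α⁻¹ : G.coeffAlgebra ≃⋆ₐ[ℂ] G.coeffAlgebra) : G.coeffAlgebra →ₗ[ℂ] G.coeffAlgebra) =
          LinearMap.id := LinearMap.ext fun x => α.apply_symm_apply x
      rw [← LinearMap.comp_apply, ← TensorProduct.map_comp, hc, TensorProduct.map_id,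
        LinearMap.id_apply]
    have h := hα (α⁻¹ a) (TensorProduct.map ((α⁻¹ : G.coeffAlgebra ≃⋆ₐ[ℂ] G.coeffAlgebra) :
            G.coeffAlgebra →ₗ[ℂ] G.coeffAlgebra)
          ((α⁻¹ : G.coeffAlgebra ≃⋆ₐ[ℂ] G.coeffAlgebra) :
            G.coeffAlgebra →ₗ[ℂ] G.coeffAlgebra) t)
    rw [e, show α (α⁻¹ a) = a from α.apply_symm_apply a] at h
    exact h.symm

/-- The automorphism group `Aut(G)`. -/
def Aut : Type u := G.autSubgroup

instance : Group G.Aut := inferInstanceAs (Group G.autSubgroup)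

variable {G} in
/-- The ⋆-algebra automorphism of the CQG algebra underlying an element of `Aut(G)`. -/
def Aut.toEquiv (α : G.Aut) : G.coeffAlgebra ≃⋆ₐ[ℂ] G.coeffAlgebra := α.1

/-- The norm of the full enveloping C⋆-algebra on the CQG algebra: the supremum of `‖π a‖` over all
⋆-homomorphisms `π` to C⋆-algebras. -/
def fullNorm (a : G.coeffAlgebra) : ℝ≥0∞ :=
  ⨆ (B : Type u) (_ : CStarAlgebra B) (π : G.coeffAlgebra →⋆ₐ[ℂ] B), ‖π a‖ₑ

/-- The topology on `Aut(G)` generated by the sets `{β | ‖β a - α a‖ < ε}` with `α ∈ Aut(G)`, `a` in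
the CQG algebra and `ε > 0`, where the norm is that of the full enveloping C⋆-algebra. Since
automorphisms are isometric, this is the group topology in which the finite intersections of the sets
`{β | ‖β a - a‖ < ε}` form a neighbourhood basis of the identity. -/
instance : TopologicalSpace G.Aut :=
  TopologicalSpace.generateFrom
    {U | ∃ (α : G.Aut) (a : G.coeffAlgebra) (ε : ℝ≥0∞), 0 < ε ∧
      U = {β : G.Aut | G.fullNorm (β.toEquiv a - α.toEquiv a) < ε}}

theorem map_mem_unitary {R S : Type u} [Ring R] [StarRing R] [Algebra ℂ R] [Ring S] [StarRing S]
    [Algebra ℂ S] {n : ℕ} (f : R →⋆ₐ[ℂ] S) {u : Matrix (Fin n) (Fin n) R}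
    (hu : u ∈ unitary (Matrix (Fin n) (Fin n) R)) : u.map f ∈ unitary (Matrix (Fin n) (Fin n) S) := by
  have hs : star (u.map f) = (star u).map f := by
    ext i j; simp [Matrix.star_apply, map_star]
  rw [Unitary.mem_iff] at hu ⊢
  rw [hs, ← Matrix.map_mul, ← Matrix.map_mul, hu.1, hu.2]
  simp [Matrix.map_one]

variable {G} in
theorem UnitaryRep.coeff_mem_unitary {n : ℕ} (w : G.UnitaryRep n) (hw : w.IsIrreducible) :
    w.coeff hw ∈ unitary (Matrix (Fin n) (Fin n) G.coeffAlgebra) := by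
  have hinj : Function.Injective
      (fun m : Matrix (Fin n) (Fin n) G.coeffAlgebra => m.map G.coeffAlgebra.subtype) :=
    Matrix.map_injective Subtype.val_injective
  have hs : (star (w.coeff hw)).map G.coeffAlgebra.subtype = star w.u := by
    ext i j; rfl
  have hc : (w.coeff hw).map G.coeffAlgebra.subtype = w.u := rfl
  have h1 : (1 : Matrix (Fin n) (Fin n) G.coeffAlgebra).map G.coeffAlgebra.subtype = 1 := by
    simp [Matrix.map_one]
  have hu := Unitary.mem_iff.mp w.mem_unitary
  rw [Unitary.mem_iff]
  constructor <;> apply hinj <;> simp only [Matrix.map_mul, hs, hc, h1, hu.1, hu.2]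

variable {G} in
/-- The representation `α(u)`, with matrix entries `α (u i j)`. -/
def Aut.mapRep (α : G.Aut) {n : ℕ} (w : G.UnitaryRep n) (hw : w.IsIrreducible) :
    G.UnitaryRep n where
  u := (w.coeff hw).map fun x => (α.toEquiv x : A)
  mem_unitary := map_mem_unitary
    (G.coeffAlgebra.subtype.comp (α.toEquiv : G.coeffAlgebra →⋆ₐ[ℂ] G.coeffAlgebra))
    (w.coeff_mem_unitary hw)
  comul_apply i j := by
    have h := (α.2 (w.coeff hw i j) (∑ k, w.coeff hw i k ⊗ₜ w.coeff hw k j)).mp (by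
      rw [map_sum]
      exact w.comul_apply i j)
    rw [map_sum, map_sum] at h
    exact h

theorem unitarilyEquivalent_mapRep_iff (α : G.Aut) {n : ℕ} (w : G.UnitaryRep n)
    (hw : w.IsIrreducible) :
    UnitarilyEquivalent w.u (α.mapRep w hw).u ↔
      UnitarilyEquivalent (w.coeff hw) ((w.coeff hw).map α.toEquiv) :=
  unitarilyEquivalent_map_iff G.coeffAlgebra.subtype.toAlgHom Subtype.val_injective
    (w.coeff hw) ((w.coeff hw).map α.toEquiv)

/-- The group `Aut_χ(G)` of inner automorphisms: the automorphisms that fix the equivalence class of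
every irreducible representation of `G`. -/
def innerAut : Subgroup G.Aut where
  carrier := {α | ∀ (n : ℕ) (w : G.UnitaryRep n) (hw : w.IsIrreducible),
    UnitarilyEquivalent w.u (α.mapRep w hw).u}
  one_mem' n w hw := UnitarilyEquivalent.refl _
  mul_mem' {α β} hα hβ n w hw := by
    have hα' := (G.unitarilyEquivalent_mapRep_iff α w hw).mp (hα n w hw)
    have hβ' := (G.unitarilyEquivalent_mapRep_iff β w hw).mp (hβ n w hw)
    refine (G.unitarilyEquivalent_mapRep_iff (α * β) w hw).mpr (hα'.trans ?_)
    exact (unitarilyEquivalent_map_iff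
      (α.toEquiv : G.coeffAlgebra →⋆ₐ[ℂ] G.coeffAlgebra).toAlgHom α.toEquiv.injective _ _).mpr hβ'
  inv_mem' {α} hα n w hw := by
    have hα' := (G.unitarilyEquivalent_mapRep_iff α w hw).mp (hα n w hw)
    refine (G.unitarilyEquivalent_mapRep_iff α⁻¹ w hw).mpr ?_
    refine (unitarilyEquivalent_map_iff
      (α.toEquiv : G.coeffAlgebra →⋆ₐ[ℂ] G.coeffAlgebra).toAlgHom α.toEquiv.injective _ _).mp ?_
    have e : ((w.coeff hw).map (α⁻¹).toEquiv).map
        (α.toEquiv : G.coeffAlgebra →⋆ₐ[ℂ] G.coeffAlgebra).toAlgHom = w.coeff hw := by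
      ext1 i j
      exact α.toEquiv.apply_symm_apply (w.coeff hw i j)
    rw [e]
    exact hα'.symm

end CompactQuantumGroup
end CQG
end

/-! The point is that the equivalence class of `α(w)` is a locally constant function of `α`, for
every irreducible `w`. Then `{α : w ≃ α(w)}` is clopen and contains the identity, hence contains
`Aut⁰(G)`. Intersecting over all `w` puts `Aut⁰(G)` inside `Aut_χ(G)`, and the two identity
components agree by maximality.

Local constancy is a perturbation argument. If `u` and `v` are representations of the same size with
nearby entries, then `v u*` is close to `1`. Averaging it over `G` gives an intertwiner `T` close to
`1`, in particular nonzero, and Schur's lemma makes a multiple of `T` a unitary as soon as `u` is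
irreducible.

The average would be `h(v u*)` for the Haar state `h`, but the Haar state itself is never
constructed. For each state `ω`, weak-* limits of Cesàro means of the convolution powers of `ω` give
a state `h` with `h * ω = h = ω * h`. The density condition on `(A ⊗ 1) Δ(A)` then makes `(id ⊗ h)
Δ(x) - h(x) 1` null for `ω` (`apply_mul_convRight_sub`). So `h(v u*)` intertwines `u` and `v` as far
as `ω` can see. The matrices with this property that satisfy the closeness bound form nonempty
compact sets, directed in `ω`; a point common to all of them is a genuine intertwiner, because
states separate points (`exists_intertwines`). -/

noncomputable section

open scoped ComplexOrder

namespace CQG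

/-! ### States, the GNS construction and norming representations -/

section States

variable {A : Type u} [CStarAlgebra A]

/-- A state of a unital C⋆-algebra. -/
structure IsState (φ : A →L[ℂ] ℂ) : Prop where
  map_one : φ 1 = 1
  nonneg : ∀ a : A, 0 ≤ φ (star a * a)

/-- For selfadjoint `a`, compare `|φ(a + it)|²` with `‖a + it‖² ≤ ‖a‖² + t²`: the `t²` terms cancel,
so a nonzero imaginary part of `φ a` would give an unbounded linear term in `t`. Positivity follows
from `‖1 - a‖ ≤ 1` for `0 ≤ a ≤ 1`. -/
theorem isState_of_norm_le_one {φ : A →L[ℂ] ℂ} (h1 : φ 1 = 1) (hφ : ‖φ‖ ≤ 1) : IsState φ := by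
  let _ := CStarAlgebra.spectralOrder A
  let _ := CStarAlgebra.spectralOrderedRing A
  have him : ∀ a : A, IsSelfAdjoint a → (φ a).im = 0 := by
    intro a ha
    have key : ∀ t : ℝ, ((φ a).im + t) ^ 2 ≤ ‖a‖ ^ 2 + t ^ 2 := by
      intro t
      have e : φ (a + (Complex.I * t) • 1) = φ a + Complex.I * t := by
        rw [map_add, map_smul, h1, smul_eq_mul, mul_one]
      have n1 : ‖φ a + Complex.I * t‖ ≤ ‖a + ((Complex.I * t) • (1 : A))‖ := by
        rw [← e]
        exact (φ.le_opNorm _).trans (mul_le_of_le_one_left (norm_nonneg _) hφ)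
      have n2 : ‖a + ((Complex.I * t) • (1 : A))‖ ^ 2 ≤ ‖a‖ ^ 2 + t ^ 2 := by
        rw [sq, ← CStarRing.norm_star_mul_self]
        have : star (a + ((Complex.I * t) • (1 : A))) * (a + ((Complex.I * t) • (1 : A))) =
            a * a + ((t ^ 2 : ℝ) : ℂ) • 1 := by
          rw [star_add, star_smul, star_one, ha.star_eq]
          have : star (Complex.I * (t : ℂ)) = -(Complex.I * t) := by simp
          rw [this]
          simp only [mul_add, add_mul, smul_mul_assoc, mul_smul_comm, one_mul, mul_one,
            neg_mul, neg_smul, smul_add, smul_smul, smul_neg]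
          have h2 : -(Complex.I * (t : ℂ) * (Complex.I * t)) = ((t ^ 2 : ℝ) : ℂ) := by
            push_cast
            linear_combination (-(t : ℂ) ^ 2) * Complex.I_mul_I
          rw [← h2, neg_smul]
          abel
        rw [this]
        refine (norm_add_le _ _).trans ?_
        gcongr
        · exact (norm_mul_le _ _).trans (sq _).ge
        · rw [norm_smul]
          have h3 : ‖(1 : A)‖ ≤ 1 := by
            rcases subsingleton_or_nontrivial A with h | h
            · rw [Subsingleton.elim (1 : A) 0]; simp
            · simp
          simpa using mul_le_mul_of_nonneg_left h3 (sq_nonneg t)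
      have n3 : ((φ a).im + t) ^ 2 ≤ ‖φ a + Complex.I * t‖ ^ 2 := by
        have := Complex.abs_im_le_norm (φ a + Complex.I * t)
        rw [← sq_abs]
        gcongr
        simpa using this
      exact n3.trans ((pow_le_pow_left₀ (norm_nonneg _) n1 2).trans n2)
    by_contra hne
    -- This `t` makes the cross term equal to `2 (‖a‖² + 1)`, more than the bound `‖a‖²` allows.
    have := key ((‖a‖ ^ 2 + 1) / (φ a).im)
    have h2 : (φ a).im * ((‖a‖ ^ 2 + 1) / (φ a).im) = ‖a‖ ^ 2 + 1 := by field_simp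
    nlinarith [sq_nonneg (φ a).im, sq_nonneg ‖a‖]
  have hpos : ∀ a : A, 0 ≤ a → ‖a‖ ≤ 1 → 0 ≤ (φ a).re := by
    intro a ha h
    have n1 : ‖1 - a‖ ≤ 1 := by
      have hle : 1 - a ≤ 1 := sub_le_self _ ha
      have h0 : 0 ≤ 1 - a := sub_nonneg.mpr (CStarAlgebra.norm_le_one_iff_of_nonneg a |>.mp h)
      exact (CStarAlgebra.norm_le_one_iff_of_nonneg (1 - a)).mpr hle
    have n2 : ‖φ (1 - a)‖ ≤ 1 :=
      (φ.le_opNorm _).trans (mul_le_one₀ hφ (norm_nonneg _) n1)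
    rw [map_sub, h1] at n2
    have := (Complex.re_le_norm _).trans n2
    simp at this
    exact this
  refine ⟨h1, fun a => ?_⟩
  rw [Complex.nonneg_iff]
  refine ⟨?_, (him _ (IsSelfAdjoint.star_mul_self a)).symm⟩
  rcases eq_or_ne (star a * a) 0 with h | h
  · simp [h]
  have hn : 0 < ‖star a * a‖ := norm_pos_iff.mpr h
  have := hpos (‖star a * a‖⁻¹ • (star a * a))
    (smul_nonneg (by positivity) (star_mul_self_nonneg a))
    (by rw [norm_smul, norm_inv, norm_norm, inv_mul_cancel₀ hn.ne'])
  rw [← Complex.coe_smul, map_smul, smul_eq_mul, Complex.re_ofReal_mul] at this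
  exact nonneg_of_mul_nonneg_right this (by positivity)

/-- The commutative C⋆-algebra generated by `star a * a` has a character attaining the norm of this
element, since norm and spectral radius agree. A Hahn–Banach extension of it is unital and
contractive, hence a state. -/
theorem exists_state_norm_eq [Nontrivial A] (a : A) :
    ∃ φ : A →L[ℂ] ℂ, IsState φ ∧ ‖φ (star a * a)‖ = ‖a‖ ^ 2 := by
  set x : A := star a * a with hx
  have hxs : IsSelfAdjoint x := IsSelfAdjoint.star_mul_self a
  let C := StarAlgebra.elemental ℂ x
  have : IsStarNormal x := hxs.isStarNormal
  let y : C := ⟨x, StarAlgebra.elemental.self_mem ℂ x⟩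
  have hy : IsSelfAdjoint y := Subtype.ext hxs
  have : Nontrivial C := inferInstance
  obtain ⟨l, hl, hln⟩ := spectrum.exists_nnnorm_eq_spectralRadius y
  rw [hy.spectralRadius_eq_nnnorm] at hln
  obtain ⟨f, hf⟩ := WeakDual.CharacterSpace.mem_spectrum_iff_exists.mp hl
  let g : (StarSubalgebra.toSubalgebra C).toSubmodule →L[ℂ] ℂ := WeakDual.toStrongDual f.1
  obtain ⟨φ, hφ, hφn⟩ := exists_extension_norm_eq (𝕜 := ℂ) _ g
  have hg : ‖g‖ ≤ 1 := by
    have hle (z : C) : ‖f z‖ ≤ ‖z‖ := AlgHom.norm_apply_le_self f z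
    refine ContinuousLinearMap.opNorm_le_bound _ zero_le_one fun z => ?_
    rw [one_mul]
    exact hle z
  refine ⟨φ, isState_of_norm_le_one ?_ (hφn.le.trans hg), ?_⟩
  · have := hφ (1 : C)
    exact this.trans (map_one f)
  · have := hφ y
    have h2 : φ x = l := this.trans hf
    rw [h2]
    have h3 : ‖l‖ = ‖y‖ := by
      have := congrArg ENNReal.toReal hln
      simpa using this
    rw [h3]
    change ‖star a * a‖ = _
    rw [CStarRing.norm_star_mul_self, sq]

/-- The Gelfand–Naimark–Segal construction: states are vector states. -/
theorem IsState.exists_hilbertRep {φ : A →L[ℂ] ℂ} (hφ : IsState φ) :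
    ∃ (π : HilbertRep A) (ξ : π.space), ‖ξ‖ = 1 ∧ ∀ a, φ a = ⟪ξ, π.hom a ξ⟫_ℂ := by
  let _ := CStarAlgebra.spectralOrder A
  let _ := CStarAlgebra.spectralOrderedRing A
  let f : A →ₚ[ℂ] ℂ := PositiveLinearMap.mk₀ (φ : A →ₗ[ℂ] ℂ) fun a ha => by
    obtain ⟨b, rfl⟩ := CStarAlgebra.nonneg_iff_eq_star_mul_self.mp ha
    exact hφ.nonneg b
  let Ω : f.GNS := ((f.toPreGNS 1 : f.PreGNS) : UniformSpace.Completion f.PreGNS)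
  have hval : ∀ a, φ a = ⟪Ω, f.gnsStarAlgHom a Ω⟫_ℂ := by
    intro a
    have h1 : f.gnsStarAlgHom a Ω = ((f.toPreGNS a : f.PreGNS) : UniformSpace.Completion f.PreGNS) := by
      have := f.gnsNonUnitalStarAlgHom_apply_coe (a := a) (b := f.toPreGNS 1)
      refine this.trans ?_
      simp
    rw [h1, UniformSpace.Completion.inner_coe, PositiveLinearMap.preGNS_inner_def]
    simp only [PositiveLinearMap.ofPreGNS_toPreGNS, star_one, one_mul]
    rfl
  have hn : ‖Ω‖ = 1 := by
    have h2 := hval 1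
    have e1 : f.gnsStarAlgHom 1 = 1 := _root_.map_one f.gnsStarAlgHom
    rw [hφ.map_one, e1, one_apply_eq_self, inner_self_eq_norm_sq_to_K] at h2
    have h3 : ‖Ω‖ ^ 2 = 1 := Complex.ofReal_injective (by push_cast; exact h2.symm)
    exact (pow_eq_one_iff_of_nonneg (norm_nonneg _) two_ne_zero).mp h3
  have : Nontrivial f.GNS := ⟨Ω, 0, fun h => by simp [h] at hn⟩
  exact ⟨{ space := f.GNS, hom := f.gnsStarAlgHom }, Ω, hn, hval⟩

/-- The GNS vector of a norm-attaining state realises the norm of `a`. Hence matrix coefficients of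
Hilbert space representations detect both equality and norm in `A`. -/
theorem exists_hilbertRep_norm_le [Nontrivial A] (a : A) :
    ∃ π : HilbertRep A, ‖a‖ ≤ ‖π.hom a‖ := by
  obtain ⟨φ, hφ, ha⟩ := exists_state_norm_eq a
  obtain ⟨π, ξ, hξ, h⟩ := hφ.exists_hilbertRep
  refine ⟨π, ?_⟩
  rw [h, map_mul, map_star, ContinuousLinearMap.star_eq_adjoint, mul_apply_eq_comp,
    ContinuousLinearMap.adjoint_inner_right, inner_self_eq_norm_sq_to_K] at ha
  have h2 : ‖π.hom a ξ‖ ^ 2 = ‖a‖ ^ 2 := by simpa using ha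
  have h3 : ‖π.hom a ξ‖ = ‖a‖ := (pow_left_inj₀ (norm_nonneg _) (norm_nonneg _) two_ne_zero).mp h2
  rw [← h3]
  simpa [hξ] using (π.hom a).le_opNorm ξ

theorem exists_isState [Nontrivial A] : ∃ φ : A →L[ℂ] ℂ, IsState φ :=
  (exists_state_norm_eq (1 : A)).imp fun _ h => h.1

theorem eq_zero_of_forall_isState [Nontrivial A] {a : A}
    (h : ∀ φ : A →L[ℂ] ℂ, IsState φ → φ (star a * a) = 0) : a = 0 := by
  obtain ⟨φ, hφ, ha⟩ := exists_state_norm_eq a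
  rw [h φ hφ, norm_zero] at ha
  exact norm_eq_zero.mp (pow_eq_zero_iff two_ne_zero |>.mp ha.symm)

theorem IsState.norm_apply_le {φ : A →L[ℂ] ℂ} (hφ : IsState φ) (a : A) : ‖φ a‖ ≤ ‖a‖ := by
  obtain ⟨π, ξ, hξ, h⟩ := hφ.exists_hilbertRep
  rw [h]
  refine (norm_inner_le_norm _ _).trans ?_
  rw [hξ, one_mul]
  refine ((π.hom a).le_opNorm ξ).trans ?_
  rw [hξ, mul_one]
  exact NonUnitalStarAlgHom.norm_apply_le π.hom a

/-- The midpoint of two states is a state. -/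
theorem IsState.midpoint {φ ψ : A →L[ℂ] ℂ} (hφ : IsState φ) (hψ : IsState ψ) :
    IsState ((2⁻¹ : ℂ) • (φ + ψ)) where
  map_one := by simp [hφ.map_one, hψ.map_one]; norm_num
  nonneg a := by
    have h2 : (0 : ℂ) ≤ 2⁻¹ := by rw [Complex.nonneg_iff]; norm_num
    exact mul_nonneg h2 (add_nonneg (hφ.nonneg a) (hψ.nonneg a))

end States

/-! ### Slice maps on the minimal tensor product -/

section Slices

theorem inner_htmul {H K : Type u}
    [NormedAddCommGroup H] [InnerProductSpace ℂ H] [CompleteSpace H]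
    [NormedAddCommGroup K] [InnerProductSpace ℂ K] [CompleteSpace K] (h h' : H) (k k' : K) :
    ⟪htmul h k, htmul h' k'⟫_ℂ = ⟪h, h'⟫_ℂ * ⟪k, k'⟫_ℂ := by
  rw [htmul, htmul, LinearIsometry.inner_map_map, TensorProduct.inner_tmul]

theorem norm_htmul {H K : Type u}
    [NormedAddCommGroup H] [InnerProductSpace ℂ H] [CompleteSpace H]
    [NormedAddCommGroup K] [InnerProductSpace ℂ K] [CompleteSpace K] (h : H) (k : K) :
    ‖htmul h k‖ = ‖h‖ * ‖k‖ := by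
  rw [htmul, LinearIsometry.norm_map, TensorProduct.norm_tmul]

theorem opTensor_htmul {H K : Type u}
    [NormedAddCommGroup H] [InnerProductSpace ℂ H] [CompleteSpace H]
    [NormedAddCommGroup K] [InnerProductSpace ℂ K] [CompleteSpace K]
    (S : H →L[ℂ] H) (T : K →L[ℂ] K) (h : H) (k : K) :
    opTensor S T (htmul h k) = htmul (S h) (T k) := opTensor_coe S T _

variable {A : Type u} [CStarAlgebra A]

/-- A functional of the form `a ↦ ⟪ξ, π a η⟫` for a ⋆-representation `π`. -/
def IsVectorFunctional (φ : A →L[ℂ] ℂ) : Prop :=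
  ∃ (π : HilbertRep A) (ξ η : π.space), ∀ a, φ a = ⟪ξ, π.hom a η⟫_ℂ

theorem IsState.isVectorFunctional {φ : A →L[ℂ] ℂ} (hφ : IsState φ) : IsVectorFunctional φ := by
  obtain ⟨π, ξ, -, h⟩ := hφ.exists_hilbertRep
  exact ⟨π, ξ, ξ, h⟩

theorem HilbertRep.inner_mul (π : HilbertRep A) (c a : A) (ξ η : π.space) :
    ⟪ξ, π.hom (c * a) η⟫_ℂ = ⟪π.hom (star c) ξ, π.hom a η⟫_ℂ := by
  rw [map_mul, map_star, ContinuousLinearMap.star_eq_adjoint, mul_apply_eq_comp,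
    ContinuousLinearMap.adjoint_inner_left]

/-- The functional `a ↦ φ (c * a)`. -/
def mulFunctional (φ : A →L[ℂ] ℂ) (c : A) : A →L[ℂ] ℂ := φ.comp (ContinuousLinearMap.mul ℂ A c)

@[simp]
theorem mulFunctional_apply (φ : A →L[ℂ] ℂ) (c a : A) : mulFunctional φ c a = φ (c * a) := rfl

/-- The factor `c` moves onto the left vector. Cut-down functionals `φ (c * ·)` are generally not
states but must still be sliced by, so slices are developed for all vector functionals. -/
theorem IsVectorFunctional.mulFunctional {φ : A →L[ℂ] ℂ} (hφ : IsVectorFunctional φ) (c : A) :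
    IsVectorFunctional (mulFunctional φ c) := by
  obtain ⟨π, ξ, η, h⟩ := hφ
  exact ⟨π, π.hom (star c) ξ, η, fun a => by rw [mulFunctional_apply, h, π.inner_mul]⟩

theorem eq_of_forall_inner [Nontrivial A] {a b : A}
    (h : ∀ (π : HilbertRep A) (ξ η : π.space), ⟪ξ, π.hom a η⟫_ℂ = ⟪ξ, π.hom b η⟫_ℂ) : a = b := by
  obtain ⟨π, hπ⟩ := exists_hilbertRep_norm_le (a - b)
  have : π.hom (a - b) = 0 := by
    ext η
    refine ext_inner_left ℂ fun ξ => ?_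
    rw [map_sub, _root_.sub_apply, inner_sub_right, h, sub_self]
    simp
  rw [this, norm_zero] at hπ
  exact sub_eq_zero.mp (norm_eq_zero.mp (le_antisymm hπ (norm_nonneg _)))

theorem denseRange_toMin : DenseRange (toMin : A ⊗[ℂ] A →⋆ₐ[ℂ] MinTensor A A) := by
  intro x
  have hx := x.2
  change _ ∈ closure (Set.range _)
  refine closure_subtype.mpr ?_
  have h : Subtype.val '' Set.range (fun t => (toMin t : minSubalgebra A A)) =
      Set.range (toRepProd (A := A) (B := A)) := (Set.range_comp _ _).symm
  exact h ▸ hx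

theorem norm_minRep_le (π σ : HilbertRep A) (X : MinTensor A A) : ‖minRep π σ X‖ ≤ ‖X‖ :=
  NonUnitalStarAlgHom.norm_apply_le (minRep π σ) X

theorem continuous_inner_minRep (π σ : HilbertRep A) (ζ ζ' : HTensor π.space σ.space) :
    Continuous fun X : MinTensor A A => ⟪ζ, minRep π σ X ζ'⟫_ℂ := by
  have h : Continuous (minRep π σ) :=
    AddMonoidHomClass.continuous_of_bound (minRep π σ) 1 fun X => by
      rw [one_mul]; exact norm_minRep_le π σ X
  fun_prop

/-- The slice map `a ⊗ b ↦ ψ b • a` on the algebraic tensor product. -/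
def algSliceRight (ψ : A →L[ℂ] ℂ) : A ⊗[ℂ] A →ₗ[ℂ] A :=
  (TensorProduct.rid ℂ A).toLinearMap ∘ₗ TensorProduct.map LinearMap.id (ψ : A →ₗ[ℂ] ℂ)

/-- The slice map `a ⊗ b ↦ φ a • b` on the algebraic tensor product. -/
def algSliceLeft (φ : A →L[ℂ] ℂ) : A ⊗[ℂ] A →ₗ[ℂ] A :=
  (TensorProduct.lid ℂ A).toLinearMap ∘ₗ TensorProduct.map (φ : A →ₗ[ℂ] ℂ) LinearMap.id

@[simp]
theorem algSliceRight_tmul (ψ : A →L[ℂ] ℂ) (a b : A) : algSliceRight ψ (a ⊗ₜ b) = ψ b • a := by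
  simp [algSliceRight]

@[simp]
theorem algSliceLeft_tmul (φ : A →L[ℂ] ℂ) (a b : A) : algSliceLeft φ (a ⊗ₜ b) = φ a • b := by
  simp [algSliceLeft]

/-- Coefficients of a slice are coefficients of `π ⊗ σ` at elementary tensors. This bounds slices by
the minimal norm and lets them extend to the completion. -/
theorem inner_algSliceRight {σ : HilbertRep A} {k k' : σ.space} {ψ : A →L[ℂ] ℂ}
    (hψ : ∀ a, ψ a = ⟪k, σ.hom a k'⟫_ℂ) (π : HilbertRep A) (h h' : π.space) (t : A ⊗[ℂ] A) :
    ⟪h, π.hom (algSliceRight ψ t) h'⟫_ℂ =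
      ⟪htmul h k, minRep π σ (toMin t) (htmul h' k')⟫_ℂ := by
  rw [minRep_toMin]
  induction t with
  | zero => simp
  | add x y hx hy => simp only [map_add, _root_.add_apply, inner_add_right, hx, hy]
  | tmul a b =>
    rw [tensorRep_tmul, opTensor_htmul, inner_htmul, algSliceRight_tmul, map_smul,
      _root_.smul_apply, inner_smul_right, hψ, mul_comm]

theorem inner_algSliceLeft {π : HilbertRep A} {h h' : π.space} {φ : A →L[ℂ] ℂ}
    (hφ : ∀ a, φ a = ⟪h, π.hom a h'⟫_ℂ) (σ : HilbertRep A) (k k' : σ.space) (t : A ⊗[ℂ] A) :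
    ⟪k, σ.hom (algSliceLeft φ t) k'⟫_ℂ =
      ⟪htmul h k, minRep π σ (toMin t) (htmul h' k')⟫_ℂ := by
  rw [minRep_toMin]
  induction t with
  | zero => simp
  | add x y hx hy => simp only [map_add, _root_.add_apply, inner_add_right, hx, hy]
  | tmul a b =>
    rw [tensorRep_tmul, opTensor_htmul, inner_htmul, algSliceLeft_tmul, map_smul,
      _root_.smul_apply, inner_smul_right, hφ]

theorem norm_le_of_forall_inner [Nontrivial A] {a : A} {C : ℝ} (hC : 0 ≤ C)
    (h : ∀ (π : HilbertRep A) (ξ η : π.space), ‖⟪ξ, π.hom a η⟫_ℂ‖ ≤ C * ‖ξ‖ * ‖η‖) : ‖a‖ ≤ C := by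
  obtain ⟨π, hπ⟩ := exists_hilbertRep_norm_le a
  refine hπ.trans (ContinuousLinearMap.opNorm_le_bound _ hC fun η => ?_)
  -- Testing against `π(a) η` itself turns the bound on coefficients into one on `‖π(a) η‖`.
  have h2 := h π (π.hom a η) η
  rw [inner_self_eq_norm_sq_to_K] at h2
  rcases (norm_nonneg (π.hom a η)).eq_or_lt with h0 | h0
  · rw [← h0]; positivity
  · have h3 : ‖π.hom a η‖ * ‖π.hom a η‖ ≤ (C * ‖η‖) * ‖π.hom a η‖ := by
      have : ‖((‖π.hom a η‖ : ℂ)) ^ 2‖ = ‖π.hom a η‖ * ‖π.hom a η‖ := by simp [sq]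
      rw [← this]
      exact h2.trans (by ring_nf; rfl)
    exact le_of_mul_le_mul_right h3 h0

theorem norm_inner_minRep_le (π σ : HilbertRep A) (h h' : π.space) (k k' : σ.space)
    (X : MinTensor A A) :
    ‖⟪htmul h k, minRep π σ X (htmul h' k')⟫_ℂ‖ ≤ ‖h‖ * ‖k‖ * (‖X‖ * (‖h'‖ * ‖k'‖)) := by
  refine (norm_inner_le_norm _ _).trans ?_
  rw [norm_htmul]
  refine mul_le_mul_of_nonneg_left ?_ (by positivity)
  refine ((minRep π σ X).le_opNorm _).trans ?_
  rw [norm_htmul]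
  exact mul_le_mul_of_nonneg_right (norm_minRep_le π σ X) (by positivity)

theorem norm_algSliceRight_le [Nontrivial A] {ψ : A →L[ℂ] ℂ} (hψ : IsVectorFunctional ψ) :
    ∃ C : ℝ, ∀ t, ‖algSliceRight ψ t‖ ≤ C * ‖toMin t‖ := by
  obtain ⟨σ, k, k', hψ⟩ := hψ
  refine ⟨‖k‖ * ‖k'‖, fun t => norm_le_of_forall_inner (by positivity) fun π h h' => ?_⟩
  rw [inner_algSliceRight hψ]
  exact (norm_inner_minRep_le π σ h h' k k' _).trans_eq (by ring)

theorem norm_algSliceLeft_le [Nontrivial A] {φ : A →L[ℂ] ℂ} (hφ : IsVectorFunctional φ) :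
    ∃ C : ℝ, ∀ t, ‖algSliceLeft φ t‖ ≤ C * ‖toMin t‖ := by
  obtain ⟨π, h, h', hφ⟩ := hφ
  refine ⟨‖h‖ * ‖h'‖, fun t => norm_le_of_forall_inner (by positivity) fun σ k k' => ?_⟩
  rw [inner_algSliceLeft hφ]
  exact (norm_inner_minRep_le π σ h h' k k' _).trans_eq (by ring)

/-- The slice map `id ⊗ ψ` on the minimal tensor product, for a vector functional `ψ`. -/
def sliceRight (ψ : A →L[ℂ] ℂ) : MinTensor A A →L[ℂ] A :=
  (algSliceRight ψ).extendOfNorm (toMin (A := A) (B := A)).toAlgHom.toLinearMap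

/-- The slice map `φ ⊗ id` on the minimal tensor product, for a vector functional `φ`. -/
def sliceLeft (φ : A →L[ℂ] ℂ) : MinTensor A A →L[ℂ] A :=
  (algSliceLeft φ).extendOfNorm (toMin (A := A) (B := A)).toAlgHom.toLinearMap

variable [Nontrivial A]

theorem sliceRight_toMin {ψ : A →L[ℂ] ℂ} (hψ : IsVectorFunctional ψ) (t : A ⊗[ℂ] A) :
    sliceRight ψ (toMin t) = algSliceRight ψ t :=
  LinearMap.extendOfNorm_eq (e := (toMin (A := A) (B := A)).toAlgHom.toLinearMap)
    denseRange_toMin (norm_algSliceRight_le hψ) t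

theorem sliceLeft_toMin {φ : A →L[ℂ] ℂ} (hφ : IsVectorFunctional φ) (t : A ⊗[ℂ] A) :
    sliceLeft φ (toMin t) = algSliceLeft φ t :=
  LinearMap.extendOfNorm_eq (e := (toMin (A := A) (B := A)).toAlgHom.toLinearMap)
    denseRange_toMin (norm_algSliceLeft_le hφ) t

theorem inner_sliceRight {σ : HilbertRep A} {k k' : σ.space} {ψ : A →L[ℂ] ℂ}
    (hψ : ∀ a, ψ a = ⟪k, σ.hom a k'⟫_ℂ) (π : HilbertRep A) (h h' : π.space) (X : MinTensor A A) :
    ⟪h, π.hom (sliceRight ψ X) h'⟫_ℂ = ⟪htmul h k, minRep π σ X (htmul h' k')⟫_ℂ := by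
  have hc : Continuous π.hom := AddMonoidHomClass.continuous_of_bound π.hom 1 fun X => by
      rw [one_mul]; exact NonUnitalStarAlgHom.norm_apply_le π.hom X
  refine denseRange_toMin.induction_on X
    (isClosed_eq (by fun_prop) (continuous_inner_minRep π σ _ _)) fun t => ?_
  rw [sliceRight_toMin ⟨σ, k, k', hψ⟩, inner_algSliceRight hψ]

theorem inner_sliceLeft {π : HilbertRep A} {h h' : π.space} {φ : A →L[ℂ] ℂ}
    (hφ : ∀ a, φ a = ⟪h, π.hom a h'⟫_ℂ) (σ : HilbertRep A) (k k' : σ.space) (X : MinTensor A A) :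
    ⟪k, σ.hom (sliceLeft φ X) k'⟫_ℂ = ⟪htmul h k, minRep π σ X (htmul h' k')⟫_ℂ := by
  have hc : Continuous σ.hom := AddMonoidHomClass.continuous_of_bound σ.hom 1 fun X => by
      rw [one_mul]; exact NonUnitalStarAlgHom.norm_apply_le σ.hom X
  refine denseRange_toMin.induction_on X
    (isClosed_eq (by fun_prop) (continuous_inner_minRep π σ _ _)) fun t => ?_
  rw [sliceLeft_toMin ⟨π, h, h', hφ⟩, inner_algSliceLeft hφ]

/-- Fubini: `φ ⊗ ψ` may be evaluated in either order. -/
theorem apply_sliceRight {φ ψ : A →L[ℂ] ℂ} (hφ : IsVectorFunctional φ)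
    (hψ : IsVectorFunctional ψ) (X : MinTensor A A) :
    φ (sliceRight ψ X) = ψ (sliceLeft φ X) := by
  obtain ⟨π, h, h', hφ⟩ := hφ
  obtain ⟨σ, k, k', hψ⟩ := hψ
  rw [hφ, hψ, inner_sliceRight hψ, inner_sliceLeft hφ]

theorem sliceRight_mul_left {ψ : A →L[ℂ] ℂ} (hψ : IsVectorFunctional ψ) (c d : A)
    (X : MinTensor A A) :
    sliceRight ψ (toMin (c ⊗ₜ d) * X) = c * sliceRight (mulFunctional ψ d) X := by
  refine denseRange_toMin.induction_on X (isClosed_eq (by fun_prop) (by fun_prop)) fun t => ?_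
  rw [← map_mul, sliceRight_toMin hψ, sliceRight_toMin (hψ.mulFunctional d)]
  induction t with
  | zero => simp
  | add x y hx hy => simp only [mul_add, map_add, hx, hy]
  | tmul a b => simp

theorem sliceLeft_mul_left {φ : A →L[ℂ] ℂ} (hφ : IsVectorFunctional φ) (c d : A)
    (X : MinTensor A A) :
    sliceLeft φ (toMin (c ⊗ₜ d) * X) = d * sliceLeft (mulFunctional φ c) X := by
  refine denseRange_toMin.induction_on X (isClosed_eq (by fun_prop) (by fun_prop)) fun t => ?_
  rw [← map_mul, sliceLeft_toMin hφ, sliceLeft_toMin (hφ.mulFunctional c)]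
  induction t with
  | zero => simp
  | add x y hx hy => simp only [mul_add, map_add, hx, hy]
  | tmul a b => simp

end Slices

/-! ### Convolution operators -/

namespace CompactQuantumGroup

variable {A : Type u} [CStarAlgebra A] (G : CompactQuantumGroup A)

theorem continuous_comul : Continuous G.comul :=
  AddMonoidHomClass.continuous_of_bound G.comul 1 fun X => by
    rw [one_mul]; exact NonUnitalStarAlgHom.norm_apply_le G.comul X

/-- Convolution `(id ⊗ ψ) ∘ Δ` by a vector functional `ψ` in the second leg. -/
def convRight (ψ : A →L[ℂ] ℂ) : A →L[ℂ] A :=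
  (sliceRight ψ).comp ⟨G.comul.toAlgHom.toLinearMap, G.continuous_comul⟩

/-- Convolution `(φ ⊗ id) ∘ Δ` by a vector functional `φ` in the first leg. -/
def convLeft (φ : A →L[ℂ] ℂ) : A →L[ℂ] A :=
  (sliceLeft φ).comp ⟨G.comul.toAlgHom.toLinearMap, G.continuous_comul⟩

theorem convRight_apply (ψ : A →L[ℂ] ℂ) (a : A) : G.convRight ψ a = sliceRight ψ (G.comul a) := rfl

theorem convLeft_apply (φ : A →L[ℂ] ℂ) (a : A) : G.convLeft φ a = sliceLeft φ (G.comul a) := rfl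

variable [Nontrivial A]

theorem apply_convRight {φ ψ : A →L[ℂ] ℂ} (hφ : IsVectorFunctional φ)
    (hψ : IsVectorFunctional ψ) (a : A) : φ (G.convRight ψ a) = ψ (G.convLeft φ a) :=
  apply_sliceRight hφ hψ _

/-- Left and right convolutions commute, by coassociativity. -/
theorem convRight_convLeft {φ ψ : A →L[ℂ] ℂ} (hφ : IsVectorFunctional φ)
    (hψ : IsVectorFunctional ψ) (a : A) :
    G.convRight ψ (G.convLeft φ a) = G.convLeft φ (G.convRight ψ a) := by
  obtain ⟨π, h, h', hφ⟩ := hφ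
  obtain ⟨τ, l, l', hψ⟩ := hψ
  refine eq_of_forall_inner fun σ k k' => ?_
  -- The outer vectors represent `φ` and `ψ`, and the middle pair is arbitrary. Slicing the last leg
  -- on one side and the first leg on the other turns coassociativity into equality of the
  -- coefficients of the two convolutions in `σ`.
  have key := G.coassoc π σ τ a h h' k k' l l'
  rw [← inner_sliceRight hψ (convRep G.comul π σ), ← inner_sliceLeft hφ (convRep G.comul σ τ)] at key
  rw [convRight_apply, convLeft_apply, inner_sliceRight hψ, convLeft_apply, inner_sliceLeft hφ]
  exact key.symm

end CompactQuantumGroup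

/-! ### Product states on the minimal tensor product -/

section

variable {A : Type u} [CStarAlgebra A]

theorem IsState.map_star {φ : A →L[ℂ] ℂ} (hφ : IsState φ) (a : A) : φ (star a) = star (φ a) := by
  obtain ⟨π, ξ, -, h⟩ := hφ.exists_hilbertRep
  rw [h, h, StarHomClass.map_star, ContinuousLinearMap.star_eq_adjoint,
    ContinuousLinearMap.adjoint_inner_right]
  exact (inner_conj_symm _ _).symm

/-- The functional `a ↦ ⟪ξ, π a η⟫`. -/
def vectorFunctional (π : HilbertRep A) (ξ η : π.space) : A →L[ℂ] ℂ :=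
  LinearMap.mkContinuous
    { toFun := fun a => ⟪ξ, π.hom a η⟫_ℂ
      map_add' := fun a b => by rw [map_add, _root_.add_apply, inner_add_right]
      map_smul' := fun c a => by
        rw [map_smul, _root_.smul_apply, inner_smul_right, RingHom.id_apply, smul_eq_mul] }
    (‖ξ‖ * ‖η‖) fun a => by
      refine (norm_inner_le_norm _ _).trans ?_
      rw [mul_assoc]
      refine mul_le_mul_of_nonneg_left ?_ (norm_nonneg _)
      rw [mul_comm]
      exact ((π.hom a).le_opNorm η).trans
        (mul_le_mul_of_nonneg_right (NonUnitalStarAlgHom.norm_apply_le π.hom a) (norm_nonneg _))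

theorem isVectorFunctional_vectorFunctional (π : HilbertRep A) (ξ η : π.space) :
    IsVectorFunctional (vectorFunctional π ξ η) := ⟨π, ξ, η, fun _ => rfl⟩

theorem eq_of_forall_isVectorFunctional [Nontrivial A] {a b : A}
    (h : ∀ φ : A →L[ℂ] ℂ, IsVectorFunctional φ → φ a = φ b) : a = b :=
  eq_of_forall_inner fun π ξ η => h _ (isVectorFunctional_vectorFunctional π ξ η)

@[simp]
theorem mulFunctional_one (φ : A →L[ℂ] ℂ) : mulFunctional φ 1 = φ := by
  ext a; simp

/-- The product of two states is a vector state. -/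
theorem IsState.exists_tensor [Nontrivial A] {φ ψ : A →L[ℂ] ℂ} (hφ : IsState φ) (hψ : IsState ψ) :
    ∃ (π σ : HilbertRep A) (ζ : HTensor π.space σ.space),
      ∀ X, φ (sliceRight ψ X) = ⟪ζ, minRep π σ X ζ⟫_ℂ := by
  obtain ⟨π, ξ, -, hξ⟩ := hφ.exists_hilbertRep
  obtain ⟨σ, η, -, hη⟩ := hψ.exists_hilbertRep
  exact ⟨π, σ, htmul ξ η, fun X => by rw [hξ, inner_sliceRight hη]⟩

theorem IsState.sliceRight_nonneg [Nontrivial A] {φ ψ : A →L[ℂ] ℂ} (hφ : IsState φ)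
    (hψ : IsState ψ) (X : MinTensor A A) : 0 ≤ φ (sliceRight ψ (star X * X)) := by
  obtain ⟨π, σ, ζ, h⟩ := hφ.exists_tensor hψ
  rw [h, map_mul, StarHomClass.map_star, ContinuousLinearMap.star_eq_adjoint, mul_apply_eq_comp,
    ContinuousLinearMap.adjoint_inner_right, inner_self_eq_norm_sq_to_K]
  exact pow_nonneg (Complex.zero_le_real.mpr (norm_nonneg (minRep π σ X ζ))) 2

theorem IsState.sliceRight_star [Nontrivial A] {φ ψ : A →L[ℂ] ℂ} (hφ : IsState φ)
    (hψ : IsState ψ) (X : MinTensor A A) :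
    φ (sliceRight ψ (star X)) = star (φ (sliceRight ψ X)) := by
  obtain ⟨π, σ, ζ, h⟩ := hφ.exists_tensor hψ
  rw [h, h, StarHomClass.map_star, ContinuousLinearMap.star_eq_adjoint,
    ContinuousLinearMap.adjoint_inner_right]
  exact (inner_conj_symm _ _).symm

/-- If `φ ⊗ ψ` is the vector state of `ζ`, the hypothesis says that `Z` kills `ζ`, and then so does
`Y * Z`. -/
theorem IsState.sliceRight_mul_eq_zero [Nontrivial A] {φ ψ : A →L[ℂ] ℂ} (hφ : IsState φ)
    (hψ : IsState ψ) {Z : MinTensor A A} (hZ : φ (sliceRight ψ (star Z * Z)) = 0)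
    (Y : MinTensor A A) : φ (sliceRight ψ (Y * Z)) = 0 := by
  obtain ⟨π, σ, ζ, h⟩ := hφ.exists_tensor hψ
  rw [h, map_mul, StarHomClass.map_star, ContinuousLinearMap.star_eq_adjoint, mul_apply_eq_comp,
    ContinuousLinearMap.adjoint_inner_right, inner_self_eq_zero] at hZ
  rw [h, map_mul, mul_apply_eq_comp, hZ, map_zero, inner_zero_right]

end

/-! ### Cesàro means and invariance under convolution by a state -/

namespace CompactQuantumGroup

variable {A : Type u} [CStarAlgebra A] [Nontrivial A] (G : CompactQuantumGroup A)

/-- The functional is the convolution `φ * ψ = (φ ⊗ ψ) ∘ Δ`, so positivity comes from that of the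
product state. Accordingly `ω.comp (G.convRight ω ^ k)` is the convolution power of exponent `k +
1`. -/
theorem isState_comp_convRight {φ ψ : A →L[ℂ] ℂ} (hφ : IsState φ) (hψ : IsState ψ) :
    IsState (φ.comp (G.convRight ψ)) where
  map_one := by
    have h : G.comul 1 = toMin ((1 : A) ⊗ₜ[ℂ] (1 : A)) := by
      rw [map_one, ← Algebra.TensorProduct.one_def, map_one]
    rw [ContinuousLinearMap.comp_apply, convRight_apply, h,
      sliceRight_toMin hψ.isVectorFunctional, algSliceRight_tmul, hψ.map_one, one_smul, hφ.map_one]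
  nonneg a := by
    rw [ContinuousLinearMap.comp_apply, convRight_apply, map_mul, map_star]
    exact hφ.sliceRight_nonneg hψ _

theorem isState_comp_convRight_pow {φ ψ : A →L[ℂ] ℂ} (hφ : IsState φ) (hψ : IsState ψ) (k : ℕ) :
    IsState (φ.comp (G.convRight ψ ^ k)) := by
  induction k with
  | zero => exact hφ
  | succ k ih => exact G.isState_comp_convRight ih hψ

/-- Cesàro averages of the convolution powers of a state. -/
def cesaro (ω : A →L[ℂ] ℂ) (n : ℕ) : A →L[ℂ] ℂ :=
  ((n : ℂ) + 1)⁻¹ • ∑ k ∈ Finset.range (n + 1), ω.comp (G.convRight ω ^ k)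

theorem isState_cesaro {ω : A →L[ℂ] ℂ} (hω : IsState ω) (n : ℕ) : IsState (G.cesaro ω n) where
  map_one := by
    have hk (k : ℕ) : ω ((G.convRight ω ^ k) 1) = 1 := (G.isState_comp_convRight_pow hω hω k).map_one
    have : (n : ℂ) + 1 ≠ 0 := by exact_mod_cast n.succ_ne_zero
    simp only [cesaro, _root_.smul_apply, sum_apply, ContinuousLinearMap.comp_apply, hk, smul_eq_mul,
      Finset.sum_const, Finset.card_range, nsmul_eq_mul, mul_one, Nat.cast_add, Nat.cast_one]
    exact inv_mul_cancel₀ this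
  nonneg a := by
    simp only [cesaro, _root_.smul_apply, sum_apply, smul_eq_mul]
    have h : (0 : ℂ) ≤ ((n : ℂ) + 1)⁻¹ := by
      have : (0 : ℝ) ≤ ((n : ℝ) + 1)⁻¹ := by positivity
      have h2 := Complex.zero_le_real.mpr this
      push_cast at h2
      exact h2
    exact mul_nonneg h (Finset.sum_nonneg fun k _ => (G.isState_comp_convRight_pow hω hω k).nonneg a)

/-- The sum telescopes to a difference of two states, each of which is contractive. -/
theorem cesaro_convRight_sub {ω : A →L[ℂ] ℂ} (hω : IsState ω) (n : ℕ) (a : A) :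
    ‖G.cesaro ω n (G.convRight ω a) - G.cesaro ω n a‖ ≤ ((n : ℝ) + 1)⁻¹ * (2 * ‖a‖) := by
  have e : G.cesaro ω n (G.convRight ω a) - G.cesaro ω n a =
      ((n : ℂ) + 1)⁻¹ * (ω ((G.convRight ω ^ (n + 1)) a) - ω a) := by
    simp only [cesaro, _root_.smul_apply, sum_apply, smul_eq_mul, ← mul_sub,
      ContinuousLinearMap.comp_apply]
    have hs (k : ℕ) : (G.convRight ω ^ k) (G.convRight ω a) = (G.convRight ω ^ (k + 1)) a := by
      rw [pow_succ]; rfl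
    simp only [hs, ← Finset.sum_sub_distrib]
    rw [Finset.sum_range_sub (fun k => ω ((G.convRight ω ^ k) a))]
    simp
  rw [e, norm_mul]
  have h1 : ‖((n : ℂ) + 1)⁻¹‖ = ((n : ℝ) + 1)⁻¹ := by
    rw [norm_inv]
    congr 1
    exact_mod_cast Complex.norm_natCast (n + 1)
  rw [h1]
  refine mul_le_mul_of_nonneg_left ?_ (by positivity)
  refine (norm_sub_le _ _).trans ?_
  rw [two_mul]
  exact add_le_add ((G.isState_comp_convRight_pow hω hω (n + 1)).norm_apply_le a)
    (hω.norm_apply_le a)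

/-- Left convolution commutes past the powers of right convolution, and `ω` composed with either one
is `ω * ω`. -/
theorem cesaro_convLeft {ω : A →L[ℂ] ℂ} (hω : IsState ω) (n : ℕ) (a : A) :
    G.cesaro ω n (G.convLeft ω a) = G.cesaro ω n (G.convRight ω a) := by
  have hv := hω.isVectorFunctional
  have hc : Commute (G.convRight ω) (G.convLeft ω) :=
    ContinuousLinearMap.ext fun x => G.convRight_convLeft hv hv x
  simp only [cesaro, _root_.smul_apply, sum_apply,
    ContinuousLinearMap.comp_apply]
  congr 1
  refine Finset.sum_congr rfl fun k _ => ?_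
  have h1 : (G.convRight ω ^ k) (G.convLeft ω a) = G.convLeft ω ((G.convRight ω ^ k) a) :=
    DFunLike.congr_fun (hc.pow_left k).eq a
  have h2 : (G.convRight ω ^ k) (G.convRight ω a) = G.convRight ω ((G.convRight ω ^ k) a) :=
    DFunLike.congr_fun ((Commute.refl (G.convRight ω)).pow_left k).eq a
  rw [h1, h2, G.apply_convRight hv hv]

open Filter Topology in
/-- For every state `ω` there is a state `h` with `h * ω = h = ω * h`. -/
theorem exists_isState_convRight_convLeft {ω : A →L[ℂ] ℂ} (hω : IsState ω) :
    ∃ h : A →L[ℂ] ℂ, IsState h ∧ (∀ a, h (G.convRight ω a) = h a) ∧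
      ∀ a, h (G.convLeft ω a) = h a := by
  -- By Banach–Alaoglu the means converge weak-* along a nonprincipal ultrafilter; no subsequence
  -- need converge.
  obtain ⟨h, -, hh⟩ := (WeakDual.isCompact_closedBall (0 : StrongDual ℂ A) 1).ultrafilter_le_nhds'
    ((hyperfilter ℕ).map fun n => StrongDual.toWeakDual (G.cesaro ω n)) (by
      refine Ultrafilter.mem_map.mpr (Filter.mem_of_superset Filter.univ_mem fun n _ => ?_)
      change dist (G.cesaro ω n) 0 ≤ 1
      rw [dist_zero_right]
      refine ContinuousLinearMap.opNorm_le_bound _ zero_le_one fun a => ?_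
      rw [one_mul]
      exact (G.isState_cesaro hω n).norm_apply_le a)
  have ht (a : A) : Tendsto (fun n => G.cesaro ω n a) (hyperfilter ℕ) (𝓝 (h a)) :=
    ((WeakDual.eval_continuous a).tendsto h).comp hh
  have hR (a : A) : h (G.convRight ω a) = h a := by
    have h0 : Tendsto (fun n => G.cesaro ω n (G.convRight ω a) - G.cesaro ω n a)
        (hyperfilter ℕ) (𝓝 0) := by
      refine Tendsto.mono_left ?_ Nat.hyperfilter_le_atTop
      refine squeeze_zero_norm (G.cesaro_convRight_sub hω · a) ?_
      have := (tendsto_one_div_add_atTop_nhds_zero_nat (𝕜 := ℝ)).mul_const (2 * ‖a‖)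
      simpa using this
    exact sub_eq_zero.mp (tendsto_nhds_unique ((ht _).sub (ht a)) h0)
  refine ⟨WeakDual.toStrongDual h, ⟨?_, fun a => ?_⟩, hR, fun a => ?_⟩
  · refine tendsto_nhds_unique (ht 1) ?_
    simp only [(G.isState_cesaro hω _).map_one]
    exact tendsto_const_nhds
  · exact ge_of_tendsto' (ht (star a * a)) fun n => (G.isState_cesaro hω n).nonneg a
  · refine (tendsto_nhds_unique (ht _) ?_).trans (hR a)
    simp only [G.cesaro_convLeft hω]
    exact ht _

/-- If `h * ω = h = ω * h` then `(d ω) * h` is a multiple of `h` for every `d`. -/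
theorem apply_mul_convRight_sub {ω h : A →L[ℂ] ℂ} (hω : IsState ω) (hh : IsState h)
    (hR : ∀ a, h (G.convRight ω a) = h a) (hL : ∀ a, h (G.convLeft ω a) = h a) (d x : A) :
    ω (d * (G.convRight h x - h x • 1)) = 0 := by
  have vω := hω.isVectorFunctional
  have vh := hh.isVectorFunctional
  -- Pairing with any `ρ` reduces this to `ω * h = h`, applied to `(ρ ⊗ id) Δ(a)`.
  have hfix (a : A) : G.convRight ω (G.convRight h a) = G.convRight h a := by
    refine eq_of_forall_isVectorFunctional fun ρ hρ => ?_
    rw [G.apply_convRight hρ vω, ← G.convRight_convLeft hρ vh, G.apply_convRight vω vh, hL,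
      G.apply_convRight hρ vh]
  -- The claim for `x = (h(c ·) ⊗ id) Δ(a)`; such elements turn out to suffice.
  have key (a c : A) : ω (d * G.convRight h (sliceLeft h (toMin (c ⊗ₜ 1) * G.comul a))) =
      ω d * h (sliceLeft h (toMin (c ⊗ₜ 1) * G.comul a)) := by
    set b := G.convRight h a with hb
    have hbs : star (h (star b * b)) = h (star b * b) := by
      rw [← hh.map_star, star_mul, star_star]
    have e1 (c : A) : sliceRight ω (toMin (c ⊗ₜ 1) * G.comul b) = c * b := by
      rw [sliceRight_mul_left vω, mulFunctional_one, ← convRight_apply, hb, hfix]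
    have hsb : star (toMin (b ⊗ₜ[ℂ] (1 : A))) = toMin (star b ⊗ₜ[ℂ] (1 : A)) := by
      rw [← map_star, TensorProduct.star_tmul, star_one]
    -- With `b` fixed under convolution by `ω`, the element `Z = Δ(b) - b ⊗ 1` is null for `h ⊗ ω`:
    -- all four terms of `Z* Z` evaluate to `h(b* b)`, the first by `h * ω = h`, the mixed ones by
    -- `hfix`.
    have hZ : h (sliceRight ω (star (G.comul b - toMin (b ⊗ₜ 1)) *
        (G.comul b - toMin (b ⊗ₜ 1)))) = 0 := by
      have t1 : h (sliceRight ω (star (G.comul b) * G.comul b)) = h (star b * b) := by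
        rw [← map_star, ← map_mul, ← convRight_apply, hR]
      have t2 : h (sliceRight ω (star (toMin (b ⊗ₜ 1)) * G.comul b)) = h (star b * b) := by
        rw [hsb, e1]
      have t3 : h (sliceRight ω (star (G.comul b) * toMin (b ⊗ₜ 1))) = h (star b * b) := by
        rw [← hbs, ← t2, ← hh.sliceRight_star hω, star_mul, star_star]
      have t4 : h (sliceRight ω (star (toMin (b ⊗ₜ 1)) * toMin (b ⊗ₜ 1))) = h (star b * b) := by
        rw [hsb, ← map_mul, Algebra.TensorProduct.tmul_mul_tmul, one_mul, sliceRight_toMin vω,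
          algSliceRight_tmul, hω.map_one, one_smul]
      rw [star_sub, sub_mul, mul_sub, mul_sub]
      simp only [map_sub, t1, t2, t3, t4]
      ring
    have h0 := hh.sliceRight_mul_eq_zero hω hZ (toMin (c ⊗ₜ d))
    rw [mul_sub, map_sub, map_sub, sub_eq_zero, ← map_mul, Algebra.TensorProduct.tmul_mul_tmul,
      mul_one, sliceRight_toMin vω, algSliceRight_tmul, map_smul, smul_eq_mul,
      sliceRight_mul_left vω] at h0
    -- Both sides are rewritten by Fubini and commuting convolutions until they are the two
    -- evaluations of `h ⊗ ω` in `h0`, on `(c ⊗ d) Δ(b)` and on `(c ⊗ d)(b ⊗ 1)`.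
    rw [← apply_sliceRight vh vh, sliceRight_mul_left vh, mulFunctional_one, ← convRight_apply,
      ← hb, ← h0, sliceLeft_mul_left vh, one_mul, ← convLeft_apply,
      G.convRight_convLeft (vh.mulFunctional c) vh, ← hb, ← mulFunctional_apply ω,
      ← G.apply_convRight (vh.mulFunctional c) (vω.mulFunctional d), mulFunctional_apply,
      convRight_apply]
  -- The identity is linear and continuous in `X`, so density of the span of `(A ⊗ 1) Δ(A)` gives it
  -- everywhere; `X = 1 ⊗ x` then recovers an arbitrary `x`, as `h(1) = 1`.
  have hall (X : MinTensor A A) :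
      ω (d * G.convRight h (sliceLeft h X)) = ω d * h (sliceLeft h X) := by
    refine closure_minimal (fun X hX => ?_) (isClosed_eq (f := fun X => ω (d * G.convRight h
      (sliceLeft h X))) (g := fun X => ω d * h (sliceLeft h X)) (by fun_prop) (by fun_prop))
      (G.dense_left X)
    change ω (d * G.convRight h (sliceLeft h X)) = ω d * h (sliceLeft h X)
    induction hX using Submodule.span_induction with
    | mem x hx => obtain ⟨c, a, rfl⟩ := hx; exact key a c
    | zero => simp
    | add x y _ _ hx hy => simp only [map_add, mul_add, hx, hy]
    | smul c x _ hx => simp only [map_smul, mul_smul_comm, smul_eq_mul, hx]; ring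
  have hx := hall (toMin (1 ⊗ₜ x))
  rw [sliceLeft_toMin vh, algSliceLeft_tmul, hh.map_one, one_smul] at hx
  rw [mul_sub, map_sub, hx, mul_smul_comm, mul_one, map_smul, smul_eq_mul]
  ring

end CompactQuantumGroup

/-! ### Algebra of intertwiners -/

section Intertwiners

variable {n : ℕ}

theorem star_map_algebraMap {R : Type u} [Ring R] [StarRing R] [Algebra ℂ R] [StarModule ℂ R]
    (T : Matrix (Fin n) (Fin n) ℂ) :
    star (T.map (algebraMap ℂ R)) = (star T).map (algebraMap ℂ R) := by
  ext i j
  exact (algebraMap_star_comm (T j i)).symm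

theorem Intertwines.mul {R : Type u} [Ring R] [Algebra ℂ R] {S T : Matrix (Fin n) (Fin n) ℂ}
    {u v w : Matrix (Fin n) (Fin n) R} (hS : Intertwines S v w) (hT : Intertwines T u v) :
    Intertwines (S * T) u w := by
  unfold Intertwines at *
  rw [Matrix.map_mul, mul_assoc, hT, ← mul_assoc, hS, mul_assoc]

theorem Intertwines.smul {R : Type u} [Ring R] [Algebra ℂ R] {T : Matrix (Fin n) (Fin n) ℂ}
    {u v : Matrix (Fin n) (Fin n) R} (hT : Intertwines T u v) (c : ℂ) :
    Intertwines (c • T) u v := by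
  have e : (c • T).map (algebraMap ℂ R) = c • T.map (algebraMap ℂ R) := by
    ext i j
    rw [Matrix.map_apply, Matrix.smul_apply, Matrix.smul_apply, Matrix.map_apply, smul_eq_mul,
      map_mul, Algebra.smul_def]
  unfold Intertwines at *
  rw [e, Matrix.smul_mul, Matrix.mul_smul, hT]

theorem Intertwines.star {R : Type u} [Ring R] [StarRing R] [Algebra ℂ R] [StarModule ℂ R]
    {T : Matrix (Fin n) (Fin n) ℂ} {u v : Matrix (Fin n) (Fin n) R}
    (hu : u ∈ unitary (Matrix (Fin n) (Fin n) R)) (hv : v ∈ unitary (Matrix (Fin n) (Fin n) R))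
    (hT : Intertwines T u v) : Intertwines (star T) v u := by
  unfold Intertwines at *
  have h := congrArg Star.star hT
  rw [star_mul, star_mul, star_map_algebraMap] at h
  calc (Star.star T).map (algebraMap ℂ R) * v
      = u * (Star.star u * (Star.star T).map (algebraMap ℂ R)) * v := by
        rw [← mul_assoc, (Unitary.mem_iff.mp hu).2, one_mul]
    _ = u * (Star.star T).map (algebraMap ℂ R) := by
        rw [h, mul_assoc, mul_assoc, (Unitary.mem_iff.mp hv).1, mul_one]

end Intertwiners

/-! ### Schur's lemma, averaging and rigidity of irreducible representations -/

namespace CompactQuantumGroup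

variable {A : Type u} [CStarAlgebra A] {G : CompactQuantumGroup A} {n : ℕ}

/-- Schur's lemma: a nonzero intertwiner out of an irreducible representation is a multiple of a
unitary. -/
theorem UnitaryRep.IsIrreducible.unitarilyEquivalent {u : G.UnitaryRep n} (hu : u.IsIrreducible)
    {v : G.UnitaryRep n} {T : Matrix (Fin n) (Fin n) ℂ} (hT : Intertwines T u.u v.u) (h0 : T ≠ 0) :
    UnitarilyEquivalent u.u v.u := by
  obtain ⟨c, hc⟩ := hu.2 (star T * T) ((hT.star u.mem_unitary v.mem_unitary).mul hT)
  let i : Fin n := ⟨0, hu.1⟩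
  -- A diagonal entry of `T* T = c 1` is the squared length of a column, so `c` is real and
  -- nonnegative; it is positive because `T* T = 0` forces `T = 0`. Dividing `T` by `√c` gives a
  -- unitary.
  have hci : c = ((∑ k, ‖T k i‖ ^ 2 : ℝ) : ℂ) := by
    have h := congrFun (congrFun hc i) i
    simp only [Matrix.mul_apply, Matrix.star_apply, Matrix.smul_apply, Matrix.one_apply_eq,
      smul_eq_mul, mul_one] at h
    rw [← h]
    push_cast
    exact Finset.sum_congr rfl fun k _ => Complex.conj_mul' _
  set r : ℝ := ∑ k, ‖T k i‖ ^ 2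
  have hr : 0 < r := by
    refine lt_of_le_of_ne (Finset.sum_nonneg fun k _ => sq_nonneg _) fun h => h0 ?_
    rw [hci, ← h, Complex.ofReal_zero, zero_smul] at hc
    exact Matrix.conjTranspose_mul_self_eq_zero.mp hc
  refine ⟨(((√r)⁻¹ : ℝ) : ℂ) • T, ?_, hT.smul _⟩
  rw [Matrix.mem_unitaryGroup_iff', star_smul, Matrix.smul_mul, Matrix.mul_smul, hc, smul_smul,
    smul_smul, hci, Complex.star_def, Complex.conj_ofReal, ← Complex.ofReal_mul,
    ← Complex.ofReal_mul]
  have : (√r)⁻¹ * (√r)⁻¹ * r = 1 := by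
    have h1 : √r ≠ 0 := (Real.sqrt_pos.mpr hr).ne'
    field_simp
    exact (Real.sq_sqrt hr.le).symm
  rw [this, Complex.ofReal_one, one_smul]

/-- Apply `Δ(v_ik u_jk*) = ∑ v_ip u_jq* ⊗ v_pk u_qk*`, slice the second leg and sum over `k`. If `T
= h(v u*)` and the left side equals `h((v u*)_ij) 1`, this reads `v T u* = T`, that is, `T u = v T`.
-/
theorem convRight_mul_star [Nontrivial A] (u v : G.UnitaryRep n) {h : A →L[ℂ] ℂ}
    (hh : IsVectorFunctional h) (i j : Fin n) :
    G.convRight h ((v.u * star u.u) i j) =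
      (v.u * ((v.u * star u.u).map h).map (algebraMap ℂ A) * star u.u) i j := by
  have e (k : Fin n) : G.convRight h (v.u i k * star (u.u j k)) =
      ∑ p, ∑ q, h (v.u p k * star (u.u q k)) • (v.u i p * star (u.u j q)) := by
    rw [convRight_apply, map_mul, map_star, v.comul_apply, u.comul_apply, star_sum,
      Finset.sum_mul_sum]
    simp only [← map_star, ← map_mul, TensorProduct.star_tmul, Algebra.TensorProduct.tmul_mul_tmul,
      map_sum, sliceRight_toMin hh, algSliceRight_tmul]
  simp only [Matrix.mul_apply, Matrix.star_apply, Matrix.map_apply, map_sum, e, Finset.sum_mul,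
    Finset.mul_sum]
  rw [Finset.sum_comm]
  refine (Finset.sum_congr rfl fun p _ => ?_).trans Finset.sum_comm
  rw [Finset.sum_comm]
  refine Finset.sum_congr rfl fun q _ => Finset.sum_congr rfl fun k _ => ?_
  rw [← Algebra.commutes, Algebra.smul_def, mul_assoc]

/-- The intertwiners averaged from the identity are as close to the identity as the two
representations are to each other. -/
theorem exists_intertwines [Nontrivial A] (u v : G.UnitaryRep n) :
    ∃ T : Matrix (Fin n) (Fin n) ℂ, Intertwines T u.u v.u ∧
      ∀ i j, ‖(1 : Matrix (Fin n) (Fin n) ℂ) i j - T i j‖ ≤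
        ‖(1 : Matrix (Fin n) (Fin n) A) i j - (v.u * star u.u) i j‖ := by
  -- The defect of `T` as an intertwiner: it vanishes exactly when `T u = v T`.
  let z (T : Fin n → Fin n → ℂ) : Matrix (Fin n) (Fin n) A :=
    v.u * (Matrix.of T).map (algebraMap ℂ A) * star u.u - (Matrix.of T).map (algebraMap ℂ A)
  have hz (i j : Fin n) : Continuous fun T => z T i j := by
    simp only [z, Matrix.sub_apply, Matrix.mul_apply, Matrix.map_apply, Matrix.of_apply]
    fun_prop
  let B : Set (Fin n → Fin n → ℂ) := {T | ∀ i j, ‖(1 : Matrix (Fin n) (Fin n) ℂ) i j - T i j‖ ≤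
    ‖(1 : Matrix (Fin n) (Fin n) A) i j - (v.u * star u.u) i j‖}
  have hB : IsCompact B := by
    have h := isCompact_univ_pi fun i : Fin n => isCompact_univ_pi fun j : Fin n =>
      isCompact_closedBall ((1 : Matrix (Fin n) (Fin n) ℂ) i j)
        ‖(1 : Matrix (Fin n) (Fin n) A) i j - (v.u * star u.u) i j‖
    convert h using 1
    ext T
    simp [B, Set.mem_pi, dist_eq_norm, norm_sub_rev (T _ _)]
  let K (ω : {ω : A →L[ℂ] ℂ // IsState ω}) : Set (Fin n → Fin n → ℂ) :=
    B ∩ {T | ∀ i j, ω.1 (star (z T i j) * z T i j) = 0}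
  have hcl (ω : {ω : A →L[ℂ] ℂ // IsState ω}) :
      IsClosed {T | ∀ i j, ω.1 (star (z T i j) * z T i j) = 0} := by
    simp only [Set.ofPred_forall]
    exact isClosed_iInter fun i => isClosed_iInter fun j =>
      isClosed_eq (by fun_prop) continuous_const
  -- The witness is `h(v u*)` for the state `h` attached to `ω`. The closeness bound holds because
  -- states are contractive, and the defect is null for `ω` on taking its adjoint as the left factor
  -- `d`.
  have hne (ω) : (K ω).Nonempty := by
    obtain ⟨h, hh, hR, hL⟩ := G.exists_isState_convRight_convLeft ω.2
    refine ⟨(v.u * star u.u).map h, fun i j => ?_, fun i j => ?_⟩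
    · have e : (1 : Matrix (Fin n) (Fin n) ℂ) i j = h ((1 : Matrix (Fin n) (Fin n) A) i j) := by
        rw [Matrix.one_apply, Matrix.one_apply]
        split_ifs
        · exact hh.map_one.symm
        · exact (map_zero h).symm
      rw [e, Matrix.map_apply, ← map_sub]
      exact hh.norm_apply_le _
    · have e : z ((v.u * star u.u).map h) i j = G.convRight h ((v.u * star u.u) i j) -
          h ((v.u * star u.u) i j) • 1 := by
        rw [convRight_mul_star u v hh.isVectorFunctional, ← Algebra.algebraMap_eq_smul_one]
        rfl
      rw [e]
      exact G.apply_mul_convRight_sub ω.2 hh hR hL _ _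
  -- Positivity makes anything null for the midpoint of two states null for both.
  have hdir : Directed (· ⊇ ·) K := by
    intro ω ω'
    refine ⟨⟨_, ω.2.midpoint ω'.2⟩, ?_⟩
    have hpos (a : A) (h : ((2⁻¹ : ℂ) • (ω.1 + ω'.1)) (star a * a) = 0) :
        ω.1 (star a * a) = 0 ∧ ω'.1 (star a * a) = 0 := by
      rw [_root_.smul_apply, smul_eq_zero, _root_.add_apply] at h
      exact (add_eq_zero_iff_of_nonneg (ω.2.nonneg a) (ω'.2.nonneg a)).mp
        (h.resolve_left (by norm_num))
    exact ⟨fun T hT => ⟨hT.1, fun i j => (hpos _ (hT.2 i j)).1⟩,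
      fun T hT => ⟨hT.1, fun i j => (hpos _ (hT.2 i j)).2⟩⟩
  have : Nonempty {ω : A →L[ℂ] ℂ // IsState ω} := nonempty_subtype.mpr exists_isState
  obtain ⟨T, hT⟩ := IsCompact.nonempty_iInter_of_directed_nonempty_isCompact_isClosed K hdir hne
    (fun ω => hB.inter_right (hcl ω)) fun ω => hB.isClosed.inter (hcl ω)
  rw [Set.mem_iInter] at hT
  refine ⟨Matrix.of T, ?_, (hT (Classical.arbitrary _)).1⟩
  have h0 : z T = 0 := by
    ext i j
    exact eq_zero_of_forall_isState fun φ hφ => (hT ⟨φ, hφ⟩).2 i j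
  have h1 := sub_eq_zero.mp h0
  unfold Intertwines
  conv_lhs => rw [← h1]
  rw [mul_assoc _ (star u.u), (Unitary.mem_iff.mp u.mem_unitary).1, mul_one]

/-- Every representation which is close to a given irreducible one is equivalent to it. -/
theorem UnitaryRep.IsIrreducible.exists_unitarilyEquivalent_of_norm_sub_lt {u : G.UnitaryRep n}
    (hu : u.IsIrreducible) :
    ∃ ε : ℝ, 0 < ε ∧ ∀ v : G.UnitaryRep n, (∀ i j, ‖v.u i j - u.u i j‖ < ε) →
      UnitarilyEquivalent u.u v.u := by
  rcases subsingleton_or_nontrivial A with hA | hA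
  · exact ⟨1, one_pos, fun v _ => ⟨1, one_mem _, by ext i j; exact Subsingleton.elim _ _⟩⟩
  let i : Fin n := ⟨0, hu.1⟩
  set s : ℝ := ∑ k, ‖u.u i k‖ with hs
  have hs0 : 0 ≤ s := Finset.sum_nonneg fun k _ => norm_nonneg _
  -- One diagonal entry suffices: that of `1 - v u* = (u - v) u*` has norm at most `s / (1 + s) <
  -- 1`, which excludes `T = 0`.
  refine ⟨(1 + s)⁻¹, by positivity, fun v hv => ?_⟩
  obtain ⟨T, hT, hT1⟩ := exists_intertwines u v
  refine hu.unitarilyEquivalent hT ?_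
  rintro rfl
  have h1 := hT1 i i
  have e : (1 : Matrix (Fin n) (Fin n) A) i i - (v.u * star u.u) i i =
      ∑ k, (u.u - v.u) i k * star u.u k i := by
    rw [← (Unitary.mem_iff.mp u.mem_unitary).2, ← Matrix.mul_apply, sub_mul, Matrix.sub_apply]
  rw [e, Matrix.one_apply_eq, Matrix.zero_apply, sub_zero, norm_one] at h1
  have h2 : ‖∑ k, (u.u - v.u) i k * star u.u k i‖ ≤ (1 + s)⁻¹ * s := by
    refine (norm_sum_le _ _).trans ?_
    rw [hs, Finset.mul_sum]
    refine Finset.sum_le_sum fun k _ => (norm_mul_le _ _).trans ?_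
    rw [Matrix.star_apply, norm_star, Matrix.sub_apply, norm_sub_rev]
    exact mul_le_mul_of_nonneg_right (hv i k).le (norm_nonneg _)
  have h3 : (1 + s)⁻¹ * s < 1 := by
    rw [inv_mul_lt_iff₀ (by positivity)]
    linarith
  linarith

/-! ### Local constancy of equivalence classes on the automorphism group -/

theorem Aut.mapRep_isIrreducible (α : G.Aut) {w : G.UnitaryRep n} (hw : w.IsIrreducible) :
    (α.mapRep w hw).IsIrreducible := by
  refine ⟨hw.1, fun T hT => hw.2 T ?_⟩
  have h1 : Intertwines T (w.coeff hw) (w.coeff hw) :=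
    (intertwines_map_iff (G.coeffAlgebra.subtype.comp
      (α.toEquiv : G.coeffAlgebra →⋆ₐ[ℂ] G.coeffAlgebra)).toAlgHom
      (Subtype.val_injective.comp α.toEquiv.injective) T _ _).mp hT
  exact (intertwines_map_iff G.coeffAlgebra.subtype.toAlgHom Subtype.val_injective T _ _).mpr h1

/-- The inclusion in `A` is one of the homomorphisms in the supremum, so closeness in the topology
of `Aut(G)` gives closeness in `A`. -/
theorem enorm_le_fullNorm (a : G.coeffAlgebra) : ‖(a : A)‖ₑ ≤ G.fullNorm a :=
  le_iSup_of_le A (le_iSup_of_le inferInstance (le_iSup_of_le G.coeffAlgebra.subtype le_rfl))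

theorem fullNorm_zero : G.fullNorm 0 = 0 := by
  simp [fullNorm]

/-- Nearby automorphisms map an irreducible representation to equivalent ones. -/
theorem exists_isOpen_unitarilyEquivalent {w : G.UnitaryRep n} (hw : w.IsIrreducible) (α : G.Aut) :
    ∃ U : Set G.Aut, IsOpen U ∧ α ∈ U ∧
      ∀ β ∈ U, UnitarilyEquivalent (α.mapRep w hw).u (β.mapRep w hw).u := by
  obtain ⟨ε, hε, h⟩ := (α.mapRep_isIrreducible hw).exists_unitarilyEquivalent_of_norm_sub_lt
  refine ⟨⋂ i, ⋂ j, {β | G.fullNorm (β.toEquiv (w.coeff hw i j) - α.toEquiv (w.coeff hw i j)) <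
    ENNReal.ofReal ε}, ?_, ?_, fun β hβ => h _ fun i j => ?_⟩
  · exact isOpen_iInter_of_finite fun i => isOpen_iInter_of_finite fun j =>
      TopologicalSpace.isOpen_generateFrom_of_mem ⟨α, _, _, ENNReal.ofReal_pos.mpr hε, rfl⟩
  · simp [fullNorm_zero, hε]
  · have h1 := (enorm_le_fullNorm _).trans_lt (Set.mem_iInter.mp (Set.mem_iInter.mp hβ i) j)
    rw [← ofReal_norm] at h1
    exact (ENNReal.ofReal_lt_ofReal_iff hε).mp h1

/-- The class of `α(w)` is constant near every `α`, so both this set and its complement are open. -/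
theorem isClopen_setOf_unitarilyEquivalent_mapRep {w : G.UnitaryRep n} (hw : w.IsIrreducible) :
    IsClopen {α : G.Aut | UnitarilyEquivalent w.u (α.mapRep w hw).u} := by
  refine ⟨isOpen_compl_iff.mp (isOpen_iff_forall_mem_open.mpr fun α hα => ?_),
    isOpen_iff_forall_mem_open.mpr fun α hα => ?_⟩ <;>
  obtain ⟨U, hU, hαU, h⟩ := exists_isOpen_unitarilyEquivalent hw α
  · exact ⟨U, fun β hβ hβ' => hα (hβ'.trans (h β hβ).symm), hU, hαU⟩
  · exact ⟨U, fun β hβ => hα.trans (h β hβ), hU, hαU⟩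

theorem connectedComponent_one_subset_innerAut :
    connectedComponent (1 : G.Aut) ⊆ (G.innerAut : Set G.Aut) := fun _ hα _ w hw =>
  (isClopen_setOf_unitarilyEquivalent_mapRep hw).connectedComponent_subset
    (UnitarilyEquivalent.refl w.u) hα

end CompactQuantumGroup

end CQG

end

theorem mainTheorem1 {A : Type u} [CStarAlgebra A] (G : CQG.CompactQuantumGroup A) :
    (Subtype.val '' connectedComponent (1 : G.innerAut) : Set G.Aut) =
      connectedComponent (1 : G.Aut) := by
  have h : connectedComponentIn (G.innerAut : Set G.Aut) 1 =
      Subtype.val '' connectedComponent (1 : G.innerAut) :=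
    connectedComponentIn_eq_image (one_mem G.innerAut)
  rw [← h]
  -- One inclusion is general; the other holds because the component of the identity in `Aut(G)` is
  -- a connected set lying inside `Aut_χ(G)`.
  exact (isPreconnected_connectedComponentIn.subset_connectedComponent
    (mem_connectedComponentIn (one_mem G.innerAut))).antisymm
    (isPreconnected_connectedComponent.subset_connectedComponentIn mem_connectedComponent
      CQG.CompactQuantumGroup.connectedComponent_one_subset_innerAut)
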